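/- Graphs are finite multigraphs, given by a finite vertex set and a finite multiset of unordered pairs of vertices. The independence polynomial of a graph $G$ is $Z_G(\lambda)=\sum_I \lambda^{\#I}$, summed over all independent sets $I\subseteq V(G)$ (no edge has all its endpoints in $I$). Let $k\ge 2$. A marked graph is a graph with $k$ distinct marked vertices labeled $1,\dots,k$. **Gluing data.** A gluing data $(H,\Sigma,\Upsilon,\Phi)$ with parameters $m,k\ge 2$ consists of: a multi-hypergraph $H$ on $V(H)=\{w_1,\dots,w_m\}$ with a finite multiset $E(H)$ of non-empty edges, each edge $e$ having a label $\ell(e)\in\{1,\dots,k\}$, such that for each $j$ the edges labeled $j$ partition $V(H)$; non-empty connected graphs $\Sigma_e$ with a root $v_e\in V(\Sigma_e)$, for $e\in E(H)$; maps $\Upsilon_e:e\to V(\Sigma_e)$, for $e\in E(H)$; and an injective map $\Phi:\{1,\dots,k\}\to E(H)$. **Recursion.** For a marked graph $G$, the marked graph $\mathcal R(G)$ is obtained from the disjoint union of $m$ copies $G(1),\dots,G(m)$ of $G$ and of all $\Sigma_e$ by identifying, for each $e\in E(H)$ and $w_i\in e$, the marked vertex of $G(i)$ labeled $\ell(e)$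 with $\Upsilon_e(w_i)$; the new label $j$ is given to the root of $\Sigma_{\Phi(j)}$. For $n\ge1$ the iterate $\mathcal R^n$ is again the recursion of a gluing data $(H_n,\Sigma_n,\Upsilon_n,\Phi_n)$, where $(H_1,\Sigma_1,\Upsilon_1,\Phi_1)=(H,\Sigma,\Upsilon,\Phi)$ and $(H_{n+1},\Sigma_{n+1},\Upsilon_{n+1},\Phi_{n+1})$ is the gluing data of $\mathcal R\circ\mathcal R^n$: $V(H_{n+1})=V(H)\times V(H_n)$; each $e\in E(H)$ with label $j$ yields an edge $e\times\Phi_n(j)$, with the label of $\Phi_n(j)$ and with connecting graph $\Sigma_e$ to which, for each $w\in e$, a copy of $\Sigma_{n,\Phi_n(j)}$ is glued by identifying its root with $\Upsilon_e(w)$; each $w\in V(H)$ and each $f\in E(H_n)$ outside the image of $\Phi_n$ yield an edge $\{w\}\times f$, with the label, connecting graph and attaching map of $f$; and $\Phi_{n+1}(j)$ is the edge arising from $\Phi(j)$. **Conditions.** Let $\Lambda(j)=\ell(\Phi(j))$; a label $j$ is periodic if $\Lambda^p(j)=j$ for some $p\ge1$. The gluing data is *stable* if for each periodic label $j$ one has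 $\#\Phi(j)=1$ and $\Sigma_{\Phi(j)}$ is the one-vertex graph $K_1$. It is *expanding* if for some $n\ge1$ the edges $\Phi_n(j)$ and $\Phi_n(l)$ are disjoint subsets of $V(H_n)$ for all $j\ne l$. A marked graph $G$ is *maximally independent* if for every $x\in\{0,1\}^k$ there is a unique independent set $I(x)$ of maximal cardinality among the independent sets that, for each $j$, contain the marked vertex labeled $j$ if and only if $x_j=1$, and moreover $\#I(1,\dots,1)-\#I(0,\dots,0)=k$. **Statement.** Suppose that the gluing data $(H,\Sigma,\Upsilon,\Phi)$ is stable and expanding and that $G_0$ is a maximally independent marked graph. Let $G_{n+1}=\mathcal R(G_n)$ for $n\ge0$. Then the zeros of the independence polynomials $Z_{G_n}(\lambda)$ are uniformly bounded: there is a constant $C$ such that for all $n\ge0$ and $\lambda\in\mathbb C$, $Z_{G_n}(\lambda)=0$ implies $|\lambda|\le C$. -/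

import Mathlib

/-- A finite multigraph: a finite vertex type and a finite multiset of unordered pairs of vertices.
Loops `s(v, v)` are permitted. -/
structure Multigraph where
  V : Type
  [fintypeV : Fintype V]
  edges : Multiset (Sym2 V)

attribute [instance] Multigraph.fintypeV

namespace Multigraph

/-- No edge of `G` has all its endpoints in `I`. -/
def IsIndep (G : Multigraph) (I : Finset G.V) : Prop :=
  ∀ e ∈ G.edges, ¬ ∀ v ∈ e, v ∈ I

def Adj (G : Multigraph) (u v : G.V) : Prop :=
  s(u, v) ∈ G.edges

/-- `G` is non-empty and any two vertices are joined by a walk. -/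
def IsConnected (G : Multigraph) : Prop :=
  Nonempty G.V ∧ ∀ u v : G.V, Relation.ReflTransGen G.Adj u v

/-- `G` is the graph `K₁`. -/
def IsSingleton (G : Multigraph) : Prop :=
  Fintype.card G.V = 1 ∧ G.edges = 0

open Classical in
/-- The independence polynomial; a vertex assignment `σ : V → {0, 1}` is encoded by `σ⁻¹(1)`. -/
noncomputable def indepPoly (G : Multigraph) : Polynomial ℂ :=
  ∑ I ∈ (Finset.univ : Finset (Finset G.V)).filter G.IsIndep, Polynomial.X ^ I.card

end Multigraph

/-- A multigraph with `k` distinct marked vertices, labeled by `Fin k`. -/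
structure MarkedGraph (k : ℕ) extends Multigraph where
  mark : Fin k → V
  mark_injective : Function.Injective mark

namespace MarkedGraph

variable {k : ℕ}

/-- `I` contains the marked vertex labeled `j` if and only if `x j = 1`. -/
def Agrees (G : MarkedGraph k) (x : Fin k → Bool) (I : Finset G.V) : Prop :=
  ∀ j, G.mark j ∈ I ↔ x j = true

/-- `I` has maximal cardinality among the independent sets of `G` that agree with `x`. -/
def IsMaxAgreeing (G : MarkedGraph k) (x : Fin k → Bool) (I : Finset G.V) : Prop :=
  G.IsIndep I ∧ G.Agrees x I ∧ ∀ J : Finset G.V, G.IsIndep J → G.Agrees x J → J.card ≤ I.card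

def IsMaximallyIndependent (G : MarkedGraph k) : Prop :=
  ∃ I : (Fin k → Bool) → Finset G.V,
    (∀ x, G.IsMaxAgreeing x (I x) ∧ ∀ J, G.IsMaxAgreeing x J → J = I x) ∧
    (((I fun _ => true).card : ℤ) - ((I fun _ => false).card : ℤ) = k)

end MarkedGraph

/-- Gluing data `(H, Σ, Υ, Φ)` with `k` labels. The multi-hypergraph `H` has vertex set `W` (so the
parameter `m` is the cardinality of `W`) and its edge multiset is indexed by `E`. -/
structure GluingData (k : ℕ) where
  W : Type
  [fintypeW : Fintype W]
  E : Type
  [fintypeE : Fintype E]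
  /-- the vertices of an edge of `H` -/
  verts : E → Finset W
  verts_nonempty : ∀ e, (verts e).Nonempty
  label : E → Fin k
  /-- the edges labeled `j` partition `W` -/
  existsUnique_edge : ∀ (w : W) (j : Fin k), ∃! e, w ∈ verts e ∧ label e = j
  /-- the connecting graphs `Σ_e` -/
  conn : E → Multigraph
  conn_connected : ∀ e, (conn e).IsConnected
  /-- the roots of the connecting graphs -/
  root : ∀ e, (conn e).V
  /-- the attaching maps `Υ_e : e → V(Σ_e)` -/
  attach : ∀ e, {w // w ∈ verts e} → (conn e).V
  /-- the labeling map `Φ` -/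
  Phi : Fin k → E
  Phi_injective : Function.Injective Phi

attribute [instance] GluingData.fintypeW GluingData.fintypeE

namespace GluingData

variable {k : ℕ}

section Recursion

variable (D : GluingData k)

/-- The edge of `H` labeled `j` that contains `w`. -/
noncomputable def edgeAt (w : D.W) (j : Fin k) : D.E :=
  (D.existsUnique_edge w j).choose

theorem mem_verts_edgeAt (w : D.W) (j : Fin k) : w ∈ D.verts (D.edgeAt w j) :=
  (D.existsUnique_edge w j).choose_spec.1.1

/-- The vertex set of `R(G)`. Every marked vertex of every copy of `G` is identified with exactly one
vertex of exactly one connecting graph, so the disjoint union of the copies `G(w)` and the graphs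
`Σ_e` becomes, after the identifications, the disjoint union of the unmarked vertices of the copies
and all vertices of the `Σ_e`. -/
abbrev RecVertex (G : MarkedGraph k) : Type :=
  (D.W × {v : G.V // ¬ ∃ j, G.mark j = v}) ⊕ (Σ e : D.E, (D.conn e).V)

open Classical in
/-- The map from the copy `G(w)` to `R(G)`: the marked vertex labeled `j` goes to `Υ_e(w)`, where `e`
is the edge labeled `j` that contains `w`. -/
noncomputable def copyMap (G : MarkedGraph k) (w : D.W) (v : G.V) : D.RecVertex G :=
  if h : ∃ j, G.mark j = v then
    Sum.inr ⟨D.edgeAt w h.choose, D.attach _ ⟨w, D.mem_verts_edgeAt w h.choose⟩⟩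
  else Sum.inl (w, ⟨v, h⟩)

/-- The identifications made in `R(G)`. -/
theorem copyMap_mark (G : MarkedGraph k) (e : D.E) (w : D.W) (hw : w ∈ D.verts e) :
    D.copyMap G w (G.mark (D.label e)) = Sum.inr ⟨e, D.attach e ⟨w, hw⟩⟩ := by
  have h : ∃ j, G.mark j = G.mark (D.label e) := ⟨_, rfl⟩
  have hj : h.choose = D.label e := G.mark_injective h.choose_spec
  have he : e = D.edgeAt w h.choose :=
    (D.existsUnique_edge w h.choose).choose_spec.2 e ⟨hw, hj.symm⟩
  unfold copyMap
  rw [dif_pos h]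
  generalize_proofs p
  revert p
  rw [← he]
  intro p
  rfl

open Classical in
/-- The graph recursion `R`: the edges of `R(G)` are the edges of all copies of `G` together with the
edges of all connecting graphs, and the new label `j` is put on the root of `Σ_{Φ(j)}`. -/
noncomputable def recursion (G : MarkedGraph k) : MarkedGraph k where
  V := D.RecVertex G
  edges := (∑ w : D.W, G.edges.map (Sym2.map (D.copyMap G w))) +
    ∑ e : D.E, (D.conn e).edges.map (Sym2.map fun v => (Sum.inr ⟨e, v⟩ : D.RecVertex G))
  mark j := Sum.inr ⟨D.Phi j, D.root (D.Phi j)⟩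
  mark_injective := fun _ _ h =>
    D.Phi_injective (congrArg Sigma.fst (Sum.inr_injective h))

/-- `G_0 = G`, `G_{n+1} = R(G_n)`. -/
noncomputable def graphSeq (G : MarkedGraph k) : ℕ → MarkedGraph k
  | 0 => G
  | n + 1 => D.recursion (graphSeq G n)

end Recursion

section Composition

variable (A B : GluingData k)

/-- The vertices of the connecting graph of the composition `R_A ∘ R_B` that arises from an edge `e`
of `A`: for every `w ∈ e` a copy of the connecting graph `Σ` of `B` whose root carries the label of
`e` is glued to `Σ_e`, by identifying the root of the copy with `Υ_e(w)`. -/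
abbrev CompVertex (e : A.E) : Type :=
  (A.conn e).V ⊕
    ({w // w ∈ A.verts e} × {v // v ≠ B.root (B.Phi (A.label e))})

open Classical in
/-- The map to that connecting graph from the copy indexed by `w ∈ e`. -/
noncomputable def compMap (e : A.E) (w : {w // w ∈ A.verts e})
    (v : (B.conn (B.Phi (A.label e))).V) : CompVertex A B e :=
  if h : v = B.root (B.Phi (A.label e)) then Sum.inl (A.attach e w) else Sum.inr (w, ⟨v, h⟩)

open Classical in
/-- The connecting graph of `R_A ∘ R_B` that arises from an edge `e` of `A`. -/
noncomputable def compConn (e : A.E) : Multigraph where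
  V := CompVertex A B e
  edges := (A.conn e).edges.map (Sym2.map Sum.inl) +
    ∑ w : {w // w ∈ A.verts e},
      (B.conn (B.Phi (A.label e))).edges.map (Sym2.map (compMap A B e w))

theorem compConn_connected (e : A.E) : (compConn A B e).IsConnected := by
  classical
  have hA : ∀ u v : (A.conn e).V,
      Relation.ReflTransGen (compConn A B e).Adj (Sum.inl u) (Sum.inl v) := by
    intro u v
    refine Relation.ReflTransGen.lift (r := (A.conn e).Adj) (p := (compConn A B e).Adj)
      Sum.inl ?_ _ _ ((A.conn_connected e).2 u v)
    intro a b hab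
    exact Multiset.mem_add.2 (Or.inl (Multiset.mem_map.2 ⟨s(a, b), hab, rfl⟩))
  have hB : ∀ (w : {w // w ∈ A.verts e}) (u v : (B.conn (B.Phi (A.label e))).V),
      Relation.ReflTransGen (compConn A B e).Adj (compMap A B e w u) (compMap A B e w v) := by
    intro w u v
    refine Relation.ReflTransGen.lift (r := (B.conn (B.Phi (A.label e))).Adj)
      (p := (compConn A B e).Adj) (compMap A B e w) ?_ _ _ ((B.conn_connected _).2 u v)
    intro a b hab
    refine Multiset.mem_add.2 (Or.inr (Multiset.mem_sum.2 ⟨w, Finset.mem_univ _, ?_⟩))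
    exact Multiset.mem_map.2 ⟨s(a, b), hab, rfl⟩
  have hroot : ∀ w, compMap A B e w (B.root (B.Phi (A.label e))) = Sum.inl (A.attach e w) :=
    fun w => dif_pos rfl
  have hne : ∀ (w : {w // w ∈ A.verts e}) (v : {v // v ≠ B.root (B.Phi (A.label e))}),
      compMap A B e w v.1 = Sum.inr (w, v) := fun w v => dif_neg v.2
  refine ⟨⟨Sum.inl (A.root e)⟩, ?_⟩
  have to_root : ∀ u : CompVertex A B e,
      Relation.ReflTransGen (compConn A B e).Adj u (Sum.inl (A.root e)) := by
    rintro (u | ⟨w, v⟩)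
    · exact hA u _
    · have h := hB w v.1 (B.root (B.Phi (A.label e)))
      rw [hroot, hne] at h
      exact h.trans (hA _ _)
  have from_root : ∀ u : CompVertex A B e,
      Relation.ReflTransGen (compConn A B e).Adj (Sum.inl (A.root e)) u := by
    rintro (u | ⟨w, v⟩)
    · exact hA _ u
    · have h := hB w (B.root (B.Phi (A.label e))) v.1
      rw [hroot, hne] at h
      exact (hA _ _).trans h
  exact fun u v => (to_root u).trans (from_root v)

open Classical in
/-- The gluing data of `R_A ∘ R_B`. The copies of `G` in `R_A(R_B(G))` are indexed by pairs
`(w, w')`. If an edge `f` of `B` is not in the image of `Φ_B`, each copy of `Σ_f` stays as it is and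
gives the edge `{w} × f`. If `f = Φ_B(j)`, the root of `Σ_f` gets the label `j` in `R_B(G)`, and the
copies of `Σ_f` are joined along the edges `e` of `A` labeled `j`, giving the edges `e × f`. -/
noncomputable def comp : GluingData k where
  W := A.W × B.W
  E := A.E ⊕ (A.W × {f : B.E // ¬ ∃ j, B.Phi j = f})
  verts := Sum.elim (fun e => A.verts e ×ˢ B.verts (B.Phi (A.label e)))
    (fun p => {p.1} ×ˢ B.verts p.2.1)
  verts_nonempty := by
    rintro (e | ⟨w, f⟩)
    · exact (A.verts_nonempty e).product (B.verts_nonempty _)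
    · exact (Finset.singleton_nonempty w).product (B.verts_nonempty _)
  label := Sum.elim (fun e => B.label (B.Phi (A.label e))) (fun p => B.label p.2.1)
  existsUnique_edge := by
    rintro ⟨w, w'⟩ ℓ
    obtain ⟨f, ⟨hf, hfl⟩, hfu⟩ := B.existsUnique_edge w' ℓ
    by_cases h : ∃ j, B.Phi j = f
    · obtain ⟨j, hj⟩ := h
      obtain ⟨e, ⟨he, hel⟩, heu⟩ := A.existsUnique_edge w j
      refine ⟨Sum.inl e, ⟨?_, ?_⟩, ?_⟩
      · simp [he, hel, hj, hf]
      · simp [hel, hj, hfl]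
      · rintro (e' | ⟨v, f'⟩) ⟨h1, h2⟩
        · simp only [Sum.elim_inl, Finset.mem_product] at h1 h2
          have h3 := hfu _ ⟨h1.2, h2⟩
          rw [← hj] at h3
          rw [heu e' ⟨h1.1, B.Phi_injective h3⟩]
        · simp only [Sum.elim_inr, Finset.mem_product] at h1 h2
          exact absurd ⟨j, hj.trans (hfu _ ⟨h1.2, h2⟩).symm⟩ f'.2
    · refine ⟨Sum.inr (w, ⟨f, h⟩), ⟨?_, ?_⟩, ?_⟩
      · simp [hf]
      · simp [hfl]
      · rintro (e' | ⟨v, f'⟩) ⟨h1, h2⟩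
        · simp only [Sum.elim_inl, Finset.mem_product] at h1 h2
          exact absurd ⟨_, hfu _ ⟨h1.2, h2⟩⟩ h
        · simp only [Sum.elim_inr, Finset.mem_product, Finset.mem_singleton] at h1 h2
          have h3 : f' = ⟨f, h⟩ := Subtype.ext (hfu _ ⟨h1.2, h2⟩)
          rw [h3, ← h1.1]
  conn := Sum.elim (fun e => compConn A B e) (fun p => B.conn p.2.1)
  conn_connected := by
    rintro (e | p)
    · exact compConn_connected A B e
    · exact B.conn_connected _
  root := fun x => match x with
    | Sum.inl e => (Sum.inl (A.root e) : CompVertex A B e)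
    | Sum.inr p => B.root p.2.1
  attach := fun x => match x with
    | Sum.inl e => fun w =>
        compMap A B e ⟨w.1.1, (Finset.mem_product.1 w.2).1⟩
          (B.attach _ ⟨w.1.2, (Finset.mem_product.1 w.2).2⟩)
    | Sum.inr p => fun w => B.attach p.2.1 ⟨w.1.2, (Finset.mem_product.1 w.2).2⟩
  Phi := fun j => Sum.inl (A.Phi j)
  Phi_injective := Sum.inl_injective.comp A.Phi_injective

end Composition

section Conditions

variable (D : GluingData k)

/-- The gluing data of the iterate `R^{n+1}`. -/
noncomputable def iterateSucc : ℕ → GluingData k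
  | 0 => D
  | n + 1 => comp D (iterateSucc n)

/-- The dynamics `Λ` on the label set. -/
def labelMap (j : Fin k) : Fin k :=
  D.label (D.Phi j)

def IsCritical (j : Fin k) : Prop :=
  2 ≤ (D.verts (D.Phi j)).card

def IsNondegenerate : Prop :=
  ∀ j ∈ Function.periodicPts D.labelMap, ¬ D.IsCritical j

def IsStable : Prop :=
  D.IsNondegenerate ∧
    ∀ j ∈ Function.periodicPts D.labelMap, (D.conn (D.Phi j)).IsSingleton

/-- For some iterate `R^{n+1}`, `n ≥ 0`, the edges `Φ_{n+1}(j)` are pairwise disjoint. -/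
def IsExpanding : Prop :=
  ∃ n : ℕ, ∀ j l : Fin k, j ≠ l →
    Disjoint ((D.iterateSucc n).verts ((D.iterateSucc n).Phi j))
      ((D.iterateSucc n).verts ((D.iterateSucc n).Phi l))

end Conditions

end GluingData

section Influence

theorem norm_mul_sub_one_le {x y : ℂ} {a b : ℝ} (hx : ‖x - 1‖ ≤ a) (hy : ‖y - 1‖ ≤ b) :
    ‖x * y - 1‖ ≤ a + b + a * b := by
  have e : x * y - 1 = (x - 1) + (y - 1) + (x - 1) * (y - 1) := by ring
  have h := norm_add₃_le (a := x - 1) (b := y - 1) (c := (x - 1) * (y - 1))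
  rw [norm_mul] at h
  rw [e]
  have h0 : 0 ≤ a := (norm_nonneg _).trans hx
  have := mul_le_mul hx hy (norm_nonneg _) h0
  linarith

theorem norm_le_one_add {y : ℂ} {c : ℝ} (hy : ‖y - 1‖ ≤ c) : ‖y‖ ≤ 1 + c := by
  have h := norm_add_le (y - 1) 1
  rw [sub_add_cancel, norm_one] at h
  linarith

theorem one_sub_le_norm {y : ℂ} {c : ℝ} (hy : ‖y - 1‖ ≤ c) : 1 - c ≤ ‖y‖ := by
  have h := norm_sub_le y (y - 1)
  rw [sub_sub_cancel, norm_one] at h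
  linarith

theorem norm_div_sub_one_le {x y : ℂ} {c d : ℝ} (hc : c < 1) (hy : ‖y - 1‖ ≤ c)
    (h : ‖x - y‖ ≤ d) : ‖x / y - 1‖ ≤ d / (1 - c) := by
  have hy' := one_sub_le_norm hy
  have hpos : 0 < ‖y‖ := by linarith
  have hy0 : y ≠ 0 := norm_pos_iff.1 hpos
  rw [div_sub_one hy0, norm_div]
  exact div_le_div₀ ((norm_nonneg _).trans h) h (by linarith) hy'

theorem norm_sum_mul_le {τ : Type*} [Fintype τ] {κ g : τ → ℂ} {T B : ℝ} (hκ : ∑ t, ‖κ t‖ ≤ T)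
    (hB : 0 ≤ B) (hg : ∀ t, ‖g t‖ ≤ B) : ‖∑ t, κ t * g t‖ ≤ T * B := by
  calc ‖∑ t, κ t * g t‖ ≤ ∑ t, ‖κ t‖ * B := by
        refine norm_sum_le_of_le _ fun t _ => ?_
        rw [norm_mul]
        exact mul_le_mul_of_nonneg_left (hg t) (norm_nonneg _)
    _ = (∑ t, ‖κ t‖) * B := (Finset.sum_mul ..).symm
    _ ≤ T * B := mul_le_mul_of_nonneg_right hκ hB

open Function

variable {ι : Type*} [DecidableEq ι] {S : ι → Type*}

/-- The multiplicative second difference of `f` in the coordinates `i` and `j`. -/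
noncomputable def mixedRatio (f : (∀ i, S i) → ℂ) (s : ∀ i, S i) (i j : ι) (t : S i) (u : S j) : ℂ :=
  f s * f (update (update s i t) j u) / (f (update s i t) * f (update s j u))

theorem mixedRatio_comm (f : (∀ i, S i) → ℂ) (s : ∀ i, S i) {i j : ι} (h : i ≠ j) (t : S i)
    (u : S j) : mixedRatio f s i j t u = mixedRatio f s j i u t := by
  unfold mixedRatio
  rw [update_comm h, mul_comm (f (update s i t))]

/-- `a` bounds the influence of every single coordinate on `f`, and `b` the interaction of every pair
of coordinates; both vanish for functions that are constant, and `b` for products of functions of a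
single coordinate. -/
structure HasInfluence (f : (∀ i, S i) → ℂ) (a : ι → ℝ) (b : ι → ι → ℝ) : Prop where
  ne_zero : ∀ s, f s ≠ 0
  influence : ∀ s i t, ‖f (update s i t) / f s - 1‖ ≤ a i
  interaction : ∀ s i j, i ≠ j → ∀ t u, ‖mixedRatio f s i j t u - 1‖ ≤ b i j

namespace HasInfluence

theorem mono {f : (∀ i, S i) → ℂ} {a a' : ι → ℝ} {b b' : ι → ι → ℝ} (h : HasInfluence f a b)
    (ha : ∀ i, a i ≤ a' i) (hb : ∀ i j, i ≠ j → b i j ≤ b' i j) : HasInfluence f a' b' :=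
  ⟨h.ne_zero, fun s i t => (h.influence s i t).trans (ha i),
    fun s i j hij t u => (h.interaction s i j hij t u).trans (hb i j hij)⟩

theorem one : HasInfluence (fun _ : ∀ i, S i => (1 : ℂ)) (fun _ => 0) (fun _ _ => 0) := by
  refine ⟨fun _ => one_ne_zero, fun _ _ _ => ?_, fun _ _ _ _ _ _ => ?_⟩ <;> simp [mixedRatio]

theorem mul {f g : (∀ i, S i) → ℂ} {a a' : ι → ℝ} {b b' : ι → ι → ℝ} (hf : HasInfluence f a b)
    (hg : HasInfluence g a' b') :
    HasInfluence (fun s => f s * g s) (fun i => (1 + a i) * (1 + a' i) - 1)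
      (fun i j => (1 + b i j) * (1 + b' i j) - 1) := by
  refine ⟨fun s => mul_ne_zero (hf.ne_zero s) (hg.ne_zero s), fun s i t => ?_,
    fun s i j hij t u => ?_⟩
  · have := norm_mul_sub_one_le (hf.influence s i t) (hg.influence s i t)
    rw [div_mul_div_comm] at this
    linarith
  · have := norm_mul_sub_one_le (hf.interaction s i j hij t u) (hg.interaction s i j hij t u)
    have e : mixedRatio (fun s => f s * g s) s i j t u =
        mixedRatio f s i j t u * mixedRatio g s i j t u := by
      unfold mixedRatio
      rw [div_mul_div_comm]
      congr 1 <;> ring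
    rw [e]
    linarith

theorem prod {κ : Type*} (A : Finset κ) {f : κ → (∀ i, S i) → ℂ} {a : κ → ι → ℝ}
    {b : κ → ι → ι → ℝ} (h : ∀ w, HasInfluence (f w) (a w) (b w)) :
    HasInfluence (fun s => ∏ w ∈ A, f w s) (fun i => ∏ w ∈ A, (1 + a w i) - 1)
      (fun i j => ∏ w ∈ A, (1 + b w i j) - 1) := by
  classical
  induction A using Finset.induction_on with
  | empty => simpa using (one : HasInfluence (fun _ : ∀ i, S i => (1 : ℂ)) _ _)
  | insert w A hw ih =>
    have := (h w).mul ih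
    simp only [add_sub_cancel] at this
    simpa only [Finset.prod_insert hw] using this

/-- Averaging over one coordinate against a complex kernel of total mass `1` and bounded total
variation. -/
noncomputable def _root_.siteAverage (f : (∀ i, S i) → ℂ) (o : ι) [Fintype (S o)]
    (κ : S o → S o → ℂ) (s : ∀ i, S i) : ℂ :=
  ∑ t, κ (s o) t * f (update s o t)

theorem siteAverage {f : (∀ i, S i) → ℂ} {a : ι → ℝ} {b : ι → ι → ℝ} (h : HasInfluence f a b)
    {M : ℝ} (ha : ∀ i, a i ≤ 1 / 8) (hb : ∀ i j, i ≠ j → b i j ≤ M) (hM : M ≤ 1 / 8) (hM0 : 0 ≤ M)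
    (o : ι) [Fintype (S o)] {κ : S o → S o → ℂ} (hκ : ∀ s, ∑ t, κ s t = 1)
    (hκ' : ∀ s, ∑ t, ‖κ s t‖ ≤ 2) :
    HasInfluence (siteAverage f o κ) (fun i => if i = o then 7 * a i else a i + 5 * M)
      (fun i j => 30 * (b i j + M ^ 2)) := by
  set θ : (∀ i, S i) → ℂ := fun s => ∑ t, κ (s o) t * (f (update s o t) / f s - 1) with hθ
  have hf : ∀ s, _root_.siteAverage f o κ s = f s * (1 + θ s) := by
    intro s
    simp only [hθ, mul_sub, mul_one, Finset.sum_sub_distrib, hκ, add_sub_cancel]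
    unfold _root_.siteAverage
    rw [Finset.mul_sum]
    refine Finset.sum_congr rfl fun t _ => ?_
    field_simp [h.ne_zero s]
  have ha0 : ∀ i, (Nonempty (∀ i, S i)) → 0 ≤ a i := fun i ⟨s⟩ =>
    (norm_nonneg _).trans (h.influence s i (s i))
  have hθa : ∀ s, ‖θ s‖ ≤ 2 * a o := fun s =>
    norm_sum_mul_le (hκ' _) (ha0 o ⟨s⟩) fun t => h.influence s o t
  have hθ4 : ∀ s, ‖(1 + θ s) - 1‖ ≤ 1 / 4 := fun s => by
    rw [add_sub_cancel_left]; linarith [hθa s, ha o]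
  have hθ0 : ∀ s, 1 + θ s ≠ 0 := fun s h0 => by
    have := hθ4 s
    rw [h0] at this
    norm_num at this
  have hρ : ∀ s i t, ‖f (update s i t) / f s‖ ≤ 9 / 8 := fun s i t => by
    linarith [norm_le_one_add ((h.influence s i t).trans (ha i))]
  have hρi : ∀ s i (hi : i ≠ o) (t : S o) (u : S i), f (update (update s i u) o t) / f (update s i u)
      - f (update s o t) / f s = f (update s o t) / f s * (mixedRatio f s i o u t - 1) := by
    intro s i hi t u
    unfold mixedRatio
    have h1 := h.ne_zero s
    have h2 := h.ne_zero (update s i u)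
    have h3 := h.ne_zero (update s o t)
    field_simp
  have hupd : ∀ s i (hi : i ≠ o) (u : S i), update s i u o = s o := fun s i hi u =>
    update_of_ne hi.symm _ _
  have hθi : ∀ (i : ι) (hi : i ≠ o) (β : ℝ)
      (hβ : ∀ (s : ∀ i, S i) t u, ‖mixedRatio f s i o t u - 1‖ ≤ β) s u,
      ‖θ (update s i u) - θ s‖ ≤ 3 * β := by
    intro i hi β hβ s u
    have hβ0 : 0 ≤ β := (norm_nonneg _).trans (hβ s u (s o))
    simp only [hθ, hupd s i hi u]
    rw [← Finset.sum_sub_distrib]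
    have := norm_sum_mul_le (B := 9 / 8 * β) (hκ' (s o)) (by positivity) (g := fun t =>
      f (update (update s i u) o t) / f (update s i u) - f (update s o t) / f s) (fun t => by
        rw [hρi s i hi, norm_mul]
        exact mul_le_mul (hρ s o t) (hβ s u t) (norm_nonneg _) (by norm_num))
    calc _ = _ := by
          congr 1
          exact Finset.sum_congr rfl fun t _ => by ring
      _ ≤ _ := this
      _ ≤ _ := by linarith
  have hquot : ∀ (i : ι) (hi : i ≠ o) (β : ℝ)
      (hβ : ∀ (s : ∀ i, S i) t u, ‖mixedRatio f s i o t u - 1‖ ≤ β) s u,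
      ‖(1 + θ (update s i u)) / (1 + θ s) - 1‖ ≤ 4 * β := by
    intro i hi β hβ s u
    have h1 := norm_div_sub_one_le (by norm_num) (hθ4 s)
      (x := 1 + θ (update s i u)) (d := 3 * β)
      (by rw [add_sub_add_left_eq_sub]; exact hθi i hi β hβ s u)
    refine h1.trans (le_of_eq (by ring))
  have hquot' : ∀ (i : ι) (hi : i ≠ o) (β : ℝ)
      (hβ : ∀ (s : ∀ i, S i) t u, ‖mixedRatio f s i o t u - 1‖ ≤ β) s u,
      ‖(1 + θ s) / (1 + θ (update s i u)) - 1‖ ≤ 4 * β := by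
    intro i hi β hβ s u
    have h1 := norm_div_sub_one_le (by norm_num) (hθ4 (update s i u))
      (x := 1 + θ s) (d := 3 * β)
      (by rw [add_sub_add_left_eq_sub, norm_sub_rev]; exact hθi i hi β hβ s u)
    refine h1.trans (le_of_eq (by ring))
  have hsite : ∀ (i : ι) (hi : i ≠ o) (β : ℝ) (hβ1 : β ≤ M)
      (hβ : ∀ (s : ∀ i, S i) t u, ‖mixedRatio f s i o t u - 1‖ ≤ β) s t u,
      ‖mixedRatio (_root_.siteAverage f o κ) s i o t u - 1‖ ≤ 30 * (β + M ^ 2) := by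
    intro i hi β hβ1 hβ s t u
    have hβ0 : 0 ≤ β := (norm_nonneg _).trans (hβ s t u)
    have e : mixedRatio (_root_.siteAverage f o κ) s i o t u = mixedRatio f s i o t u *
        ((1 + θ s) / (1 + θ (update s i t)) *
          ((1 + θ (update (update s o u) i t)) / (1 + θ (update s o u)))) := by
      unfold mixedRatio
      simp only [hf]
      rw [update_comm hi]
      simp only [div_mul_div_comm]
      congr 1 <;> ring
    rw [e]
    refine (norm_mul_sub_one_le (hβ s t u) (norm_mul_sub_one_le (hquot' i hi β hβ s t)
      (hquot i hi β hβ (update s o u) t))).trans ?_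
    nlinarith [mul_nonneg hβ0 hβ0, mul_nonneg hM0 hM0, mul_nonneg hβ0 (mul_nonneg hβ0 hβ0)]
  refine ⟨fun s => ?_, fun s i t => ?_, fun s i j hij t u => ?_⟩
  · rw [hf]
    exact mul_ne_zero (h.ne_zero s) (hθ0 s)
  · rw [hf, hf, mul_div_mul_comm]
    have ha0 := ha0 i ⟨s⟩
    by_cases hi : i = o
    · subst hi
      rw [if_pos rfl]
      have h1 := norm_div_sub_one_le (by norm_num) (hθ4 s)
        (x := 1 + θ (update s i t)) (d := 4 * a i)
        (by rw [add_sub_add_left_eq_sub]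
            linarith [norm_sub_le (θ (update s i t)) (θ s), hθa s, hθa (update s i t)])
      refine (norm_mul_sub_one_le (h.influence s i t) h1).trans ?_
      have h2 : 4 * a i / (1 - 1 / 4) = 16 / 3 * a i := by ring
      rw [h2]
      nlinarith [mul_le_mul_of_nonneg_left (ha i) ha0]
    · rw [if_neg hi]
      have h1 := hquot i hi M (fun s t u => (h.interaction s i o hi t u).trans (hb i o hi)) s t
      refine (norm_mul_sub_one_le (h.influence s i t) h1).trans ?_
      nlinarith [ha i]
  · by_cases hi : i = o
    · subst hi
      rw [mixedRatio_comm _ _ hij]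
      refine hsite j hij.symm _ (hb i j hij) (fun s t u => ?_) s u t
      rw [mixedRatio_comm _ _ hij.symm]
      exact h.interaction s i j hij u t
    by_cases hj : j = o
    · subst hj
      exact hsite i hij _ (hb i j hij) (fun s t u => h.interaction s i j hij t u) s t u
    have hb0 : 0 ≤ b i j := (norm_nonneg _).trans (h.interaction s i j hij t u)
    have hbM := hb i j hij
    set A := θ (update s i t) - θ s with hA
    set B := θ (update s j u) - θ s with hB
    set G := θ (update (update s i t) j u) - θ (update s i t) - θ (update s j u) + θ s with hG
    have hA3 : ‖A‖ ≤ 3 * M :=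
      hθi i hi M (fun s t u => (h.interaction s i o hi t u).trans (hb i o hi)) s t
    have hB3 : ‖B‖ ≤ 3 * M :=
      hθi j hj M (fun s t u => (h.interaction s j o hj t u).trans (hb j o hj)) s u
    have hG3 : ‖G‖ ≤ 3 * M ^ 2 + 9 * b i j := by
      have e : G = ∑ v, κ (s o) v * (f (update (update (update s i t) j u) o v) /
          f (update (update s i t) j u) - f (update (update s i t) o v) / f (update s i t)
          - f (update (update s j u) o v) / f (update s j u) + f (update s o v) / f s) := by
        simp only [hG, hθ, hupd _ i hi, hupd _ j hj]
        rw [← Finset.sum_sub_distrib, ← Finset.sum_sub_distrib, ← Finset.sum_add_distrib]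
        exact Finset.sum_congr rfl fun v _ => by ring
      rw [e]
      refine (norm_sum_mul_le (hκ' (s o)) (B := 9 / 8 * (M ^ 2 + (1 + M) ^ 2 * (3 * b i j)))
        (by positivity) fun v => ?_).trans (by
          have h1 : (1 + M) ^ 2 ≤ 81 / 64 := by nlinarith
          nlinarith [mul_le_mul_of_nonneg_right h1 hb0, sq_nonneg M])
      have hγ : ‖mixedRatio f (update s o v) i j t u / mixedRatio f s i j t u - 1‖ ≤ 3 * b i j := by
        have h1 := h.interaction (update s o v) i j hij t u
        have h2 := h.interaction s i j hij t u
        refine (norm_div_sub_one_le (c := 1 / 8) (d := 2 * b i j) (by norm_num) (by linarith) ?_).trans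
          (by rw [div_le_iff₀ (by norm_num)]; linarith)
        have := norm_sub_le (mixedRatio f (update s o v) i j t u - 1) (mixedRatio f s i j t u - 1)
        rw [sub_sub_sub_cancel_right] at this
        linarith
      have hα := (h.interaction s i o hi t v).trans (hb i o hi)
      have hβ := (h.interaction s j o hj u v).trans (hb j o hj)
      set γ := mixedRatio f (update s o v) i j t u / mixedRatio f s i j t u - 1 with hγ'
      set α := mixedRatio f s i o t v - 1 with hα'
      set β := mixedRatio f s j o u v - 1 with hβ'
      have e2 : f (update (update (update s i t) j u) o v) /
          f (update (update s i t) j u) - f (update (update s i t) o v) / f (update s i t)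
          - f (update (update s j u) o v) / f (update s j u) + f (update s o v) / f s =
          f (update s o v) / f s * (α * β + (1 + α) * (1 + β) * γ) := by
        simp only [hγ', hα', hβ', mixedRatio]
        rw [update_comm (Ne.symm hi) v t s, update_comm (Ne.symm hj) v u s,
          update_comm (Ne.symm hj) v u (update s i t)]
        have h1 := h.ne_zero s
        have h2 := h.ne_zero (update s i t)
        have h3 := h.ne_zero (update s j u)
        have h4 := h.ne_zero (update s o v)
        have h5 := h.ne_zero (update (update s i t) j u)
        have h6 := h.ne_zero (update (update s i t) o v)
        have h7 := h.ne_zero (update (update s j u) o v)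
        field_simp
        ring
      rw [e2, norm_mul]
      refine mul_le_mul (hρ s o v) ?_ (norm_nonneg _) (by norm_num)
      refine (norm_add_le _ _).trans (add_le_add ?_ ?_)
      · rw [norm_mul, sq]
        exact mul_le_mul hα hβ (norm_nonneg _) hM0
      · have h1 : ‖1 + α‖ ≤ 1 + M := (norm_add_le _ _).trans (by rw [norm_one]; linarith)
        have h2 : ‖1 + β‖ ≤ 1 + M := (norm_add_le _ _).trans (by rw [norm_one]; linarith)
        rw [norm_mul, norm_mul, sq]
        exact mul_le_mul (mul_le_mul h1 h2 (norm_nonneg _) (by linarith)) hγ (norm_nonneg _)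
          (by positivity)
    have e : mixedRatio (_root_.siteAverage f o κ) s i j t u = mixedRatio f s i j t u *
        ((1 + θ s) * (1 + θ (update (update s i t) j u)) /
          ((1 + θ (update s i t)) * (1 + θ (update s j u)))) := by
      unfold mixedRatio
      simp only [hf]
      simp only [div_mul_div_comm]
      congr 1 <;> ring
    have hq : ‖(1 + θ s) * (1 + θ (update (update s i t) j u)) /
          ((1 + θ (update s i t)) * (1 + θ (update s j u))) - 1‖ ≤ 24 * M ^ 2 + 22 * b i j := by
      have hD : 9 / 16 ≤ ‖(1 + θ (update s i t)) * (1 + θ (update s j u))‖ := by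
        rw [norm_mul]
        nlinarith [one_sub_le_norm (hθ4 (update s i t)), one_sub_le_norm (hθ4 (update s j u))]
      have e3 : (1 + θ s) * (1 + θ (update (update s i t) j u)) -
          ((1 + θ (update s i t)) * (1 + θ (update s j u))) = (1 + θ s) * G - A * B := by
        simp only [hA, hB, hG]; ring
      rw [div_sub_one (mul_ne_zero (hθ0 _) (hθ0 _)), e3, norm_div, div_le_iff₀ (by linarith)]
      have h1 : ‖1 + θ s‖ ≤ 5 / 4 := by linarith [norm_le_one_add (hθ4 s)]
      have h2 := norm_sub_le ((1 + θ s) * G) (A * B)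
      rw [norm_mul, norm_mul] at h2
      have h3 := mul_le_mul h1 hG3 (norm_nonneg _) (by norm_num)
      have h4 := mul_le_mul hA3 hB3 (norm_nonneg _) (by positivity)
      have h5 : (24 * M ^ 2 + 22 * b i j) * (9 / 16) ≤ (24 * M ^ 2 + 22 * b i j) *
        ‖(1 + θ (update s i t)) * (1 + θ (update s j u))‖ :=
        mul_le_mul_of_nonneg_left hD (by positivity)
      nlinarith
    rw [e]
    refine (norm_mul_sub_one_le (h.interaction s i j hij t u) hq).trans ?_
    nlinarith [mul_nonneg hb0 (sq_nonneg M), mul_nonneg hb0 hb0]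

end HasInfluence

theorem siteAverage_of_eq_ite {f : (∀ i, S i) → ℂ} {o : ι} [Fintype (S o)]
    [DecidableEq (S o)] {κ : S o → S o → ℂ}
    (hκ : ∀ s t, κ s t = if s = t then 1 else 0) : siteAverage f o κ = f := by
  funext s
  unfold siteAverage
  rw [Finset.sum_eq_single (s o)]
  · simp [hκ]
  · intro t _ ht
    simp [hκ, ht.symm]
  · simp

end Influence

section MultiAverage

open Function

variable {ι : Type*} [DecidableEq ι] {S : ι → Type*} [Fintype ι] [∀ i, Fintype (S i)]
  [∀ i, DecidableEq (S i)]

/-- Averaging over all coordinates in `A`. -/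
noncomputable def multiAverage (κ : ∀ i, S i → S i → ℂ) (A : Finset ι) (f : (∀ i, S i) → ℂ)
    (s : ∀ i, S i) : ℂ :=
  ∑ t : ∀ i, S i, (∏ i, if i ∈ A then κ i (s i) (t i) else if s i = t i then 1 else 0) * f t

theorem multiAverage_empty (κ : ∀ i, S i → S i → ℂ) (f : (∀ i, S i) → ℂ) :
    multiAverage κ ∅ f = f := by
  funext s
  unfold multiAverage
  rw [Finset.sum_eq_single s]
  · simp
  · intro t _ hts
    obtain ⟨i, hi⟩ := Function.ne_iff.1 hts
    rw [Finset.prod_eq_zero (Finset.mem_univ i), zero_mul]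
    simp [hi.symm]
  · simp

theorem siteAverage_multiAverage (κ : ∀ i, S i → S i → ℂ) {A : Finset ι} {o : ι} (ho : o ∉ A)
    (f : (∀ i, S i) → ℂ) :
    siteAverage (multiAverage κ A f) o (κ o) = multiAverage κ (insert o A) f := by
  funext s
  unfold siteAverage multiAverage
  simp only [Finset.mul_sum]
  rw [Finset.sum_comm]
  refine Finset.sum_congr rfl fun t _ => ?_
  have h1 : ∀ u : S o, (∏ i, if i ∈ A then κ i (update s o u i) (t i) else
      if update s o u i = t i then 1 else 0) = (if u = t o then (1 : ℂ) else 0) *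
        ∏ i ∈ Finset.univ.erase o, if i ∈ A then κ i (s i) (t i) else
          if s i = t i then 1 else 0 := by
    intro u
    rw [← Finset.mul_prod_erase _ _ (Finset.mem_univ o)]
    congr 1
    · simp [ho]
    · refine Finset.prod_congr rfl fun i hi => ?_
      rw [update_of_ne (Finset.ne_of_mem_erase hi)]
  have h2 : (∏ i, if i ∈ insert o A then κ i (s i) (t i) else
      if s i = t i then 1 else 0) = κ o (s o) (t o) *
        ∏ i ∈ Finset.univ.erase o, if i ∈ A then κ i (s i) (t i) else
          if s i = t i then 1 else 0 := by
    rw [← Finset.mul_prod_erase _ _ (Finset.mem_univ o)]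
    congr 1
    · simp
    · refine Finset.prod_congr rfl fun i hi => ?_
      simp [Finset.mem_insert, Finset.ne_of_mem_erase hi]
  simp only [h1, h2]
  rw [Finset.sum_eq_single (t o)]
  · simp [mul_assoc]
  · intro u _ hu
    simp [hu]
  · simp

open Classical in
theorem HasInfluence.exists_multiAverage (A : Finset ι) :
    ∃ C : ℝ, 1 ≤ C ∧ ∀ (f : (∀ i, S i) → ℂ) (a : ι → ℝ) (b : ι → ι → ℝ) (M : ℝ)
      (κ : ∀ i, S i → S i → ℂ) (rigid : ι → Prop), HasInfluence f a b →
      (∀ i, 0 ≤ a i) → (∀ i j, 0 ≤ b i j) → (∀ i, C * a i ≤ 1 / 16) → (∀ i j, b i j ≤ M) →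
      0 ≤ M → C * M ≤ 1 / 16 → (∀ i s, ∑ t, κ i s t = 1) → (∀ i s, ∑ t, ‖κ i s t‖ ≤ 2) →
      (∀ i, rigid i → ∀ s t, κ i s t = if s = t then 1 else 0) →
      HasInfluence (multiAverage κ A f) (fun i => if rigid i then a i + C * M else C * (a i + M))
        (fun i j => C * (b i j + M ^ 2)) := by
  induction A using Finset.induction_on with
  | empty =>
    refine ⟨1, le_rfl, fun f a b M κ rigid h _ _ _ _ hM _ _ _ _ => ?_⟩
    rw [multiAverage_empty]
    refine h.mono (fun i => ?_) (fun i j _ => ?_)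
    · split_ifs <;> linarith
    · nlinarith [sq_nonneg M]
  | insert o A ho ih =>
    obtain ⟨C, hC, ih⟩ := ih
    have hCC : C ≤ 150 * C ^ 2 := by nlinarith
    have hCC' : 11 * C ≤ 150 * C ^ 2 := by nlinarith
    refine ⟨150 * C ^ 2, by linarith, fun f a b M κ rigid h ha0 hb0 ha hb hM0 hM hκ hκ' hr => ?_⟩
    have ha' : ∀ i, C * a i ≤ 1 / 16 := fun i =>
      (mul_le_mul_of_nonneg_right hCC (ha0 i)).trans (ha i)
    have hM' : C * M ≤ 1 / 16 := (mul_le_mul_of_nonneg_right hCC hM0).trans hM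
    have hM1 : M ≤ 1 / 16 := by nlinarith
    have hCM : C * M ≤ 150 * C ^ 2 * M := mul_le_mul_of_nonneg_right hCC hM0
    have hCM' : 11 * C * M ≤ 150 * C ^ 2 * M := mul_le_mul_of_nonneg_right hCC' hM0
    have hCM0 : 0 ≤ C * M := by positivity
    have hA := ih f a b M κ rigid h ha0 hb0 ha' hb hM0 hM' hκ hκ' hr
    rw [← siteAverage_multiAverage κ ho]
    by_cases hro : rigid o
    · rw [siteAverage_of_eq_ite (hr o hro)]
      refine hA.mono (fun i => ?_) (fun i j _ => ?_)
      · split_ifs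
        · linarith
        · exact mul_le_mul_of_nonneg_right hCC (add_nonneg (ha0 i) hM0)
      · exact mul_le_mul_of_nonneg_right hCC (add_nonneg (hb0 i j) (sq_nonneg M))
    · have hMM : C * (M + M ^ 2) ≤ 2 * (C * M) := by nlinarith
      refine (hA.siteAverage (M := 2 * (C * M)) (fun i => ?_) (fun i j _ => ?_) (by linarith)
        (by positivity) o (hκ o) (hκ' o)).mono (fun i => ?_) (fun i j _ => ?_)
      · split_ifs
        · nlinarith [ha' i, ha0 i]
        · nlinarith [ha' i, ha0 i]
      · have := mul_le_mul_of_nonneg_left (hb i j) (by linarith : 0 ≤ C)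
        nlinarith
      · have h1 := mul_le_mul_of_nonneg_right hCC' (ha0 i)
        have h2 : 0 ≤ C * a i := mul_nonneg (by linarith) (ha0 i)
        by_cases hi : i = o
        · subst hi
          simp only [if_true, if_neg hro]
          linarith
        · simp only [if_neg hi]
          split_ifs <;> linarith
      · have hb' := hb0 i j
        have h1 : C * b i j ≤ C ^ 2 * b i j := by
          refine mul_le_mul_of_nonneg_right ?_ hb'
          nlinarith
        have h2 : C * M ^ 2 ≤ C ^ 2 * M ^ 2 := by
          refine mul_le_mul_of_nonneg_right ?_ (sq_nonneg M)
          nlinarith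
        nlinarith [mul_nonneg (sq_nonneg C) hb']

end MultiAverage

section ScalarRecursion

open Finset

theorem one_add_pow_sub_one_le (n : ℕ) {x : ℝ} (h0 : 0 ≤ x) (h1 : x ≤ 1) :
    (1 + x) ^ n - 1 ≤ (2 ^ n - 1) * x := by
  induction n with
  | zero => simp
  | succ n ih =>
    have h2 : (1 : ℝ) ≤ 2 ^ n := one_le_pow₀ (by norm_num)
    rw [pow_succ, pow_succ]
    nlinarith [mul_nonneg (sub_nonneg.2 h2) h0,
      mul_le_mul_of_nonneg_right ih (by linarith : 0 ≤ 1 + x),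
      mul_nonneg (mul_nonneg (sub_nonneg.2 h2) h0) (sub_nonneg.2 h1)]

variable {ι : Type*} [Fintype ι]

open Classical in
/-- The bounds for influences and interactions after `n` steps of a recursion in which the pair
`(j, l)` inherits its interaction from `(Λ j, Λ l)` if `j` and `l` are linked. -/
noncomputable def influenceSeq (Λ : ι → ι) (linked : ι → ι → Prop) (C ε : ℝ) :
    ℕ → (ι → ℝ) × (ι → ι → ℝ)
  | 0 => (fun _ => ε, fun _ _ => ε)
  | n + 1 =>
    let a := (influenceSeq Λ linked C ε n).1
    let b := (influenceSeq Λ linked C ε n).2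
    let M := ∑ j, ∑ l, b j l
    (fun j => if j ∈ Function.periodicPts Λ then a (Λ j) + C * M else C * (a (Λ j) + M),
      fun j l => C * ((if linked j l then b (Λ j) (Λ l) else 0) + M ^ 2))

variable {Λ : ι → ι} {linked : ι → ι → Prop} {C ε : ℝ}

noncomputable def totalInteraction (Λ : ι → ι) (linked : ι → ι → Prop) (C ε : ℝ) (n : ℕ) : ℝ :=
  ∑ j, ∑ l, (influenceSeq Λ linked C ε n).2 j l

open Classical in
theorem influenceSeq_snd_nonneg (hC : 1 ≤ C) (hε : 0 ≤ ε) (n : ℕ) (j l : ι) :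
    0 ≤ (influenceSeq Λ linked C ε n).2 j l := by
  induction n generalizing j l with
  | zero => exact hε
  | succ n ih =>
    simp only [influenceSeq]
    have : 0 ≤ if linked j l then (influenceSeq Λ linked C ε n).2 (Λ j) (Λ l) else 0 := by
      split_ifs
      · exact ih _ _
      · exact le_rfl
    positivity

theorem totalInteraction_nonneg (hC : 1 ≤ C) (hε : 0 ≤ ε) (n : ℕ) :
    0 ≤ totalInteraction Λ linked C ε n :=
  sum_nonneg fun _ _ => sum_nonneg fun _ _ => influenceSeq_snd_nonneg hC hε n _ _

theorem influenceSeq_snd_le_total (hC : 1 ≤ C) (hε : 0 ≤ ε) (n : ℕ) (j l : ι) :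
    (influenceSeq Λ linked C ε n).2 j l ≤ totalInteraction Λ linked C ε n :=
  (single_le_sum (f := fun l => (influenceSeq Λ linked C ε n).2 j l)
    (fun _ _ => influenceSeq_snd_nonneg hC hε n _ _) (mem_univ l)).trans
  (single_le_sum (f := fun j => ∑ l, (influenceSeq Λ linked C ε n).2 j l)
    (fun _ _ => sum_nonneg fun _ _ => influenceSeq_snd_nonneg hC hε n _ _) (mem_univ j))

theorem influenceSeq_fst_nonneg (hC : 1 ≤ C) (hε : 0 ≤ ε) (n : ℕ) (j : ι) :
    0 ≤ (influenceSeq Λ linked C ε n).1 j := by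
  induction n generalizing j with
  | zero => exact hε
  | succ n ih =>
    simp only [influenceSeq]
    have h1 := ih (Λ j)
    have h2 := totalInteraction_nonneg (Λ := Λ) (linked := linked) hC hε n
    unfold totalInteraction at h2
    split_ifs <;> positivity

open Classical in
/-- Along `i` steps, the interaction grows by a bounded factor, and unlinked chains only retain the
quadratic part. -/
theorem exists_interaction_bound (Λ : ι → ι) (linked : ι → ι → Prop) (hC : 1 ≤ C) (i : ℕ) :
    ∃ K : ℝ, 1 ≤ K ∧ ∀ (ε : ℝ) (n : ℕ), 0 ≤ ε → totalInteraction Λ linked C ε n ≤ 1 →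
      K * totalInteraction Λ linked C ε n ≤ 1 → ∀ j l,
      (influenceSeq Λ linked C ε (n + i)).2 j l ≤ K * totalInteraction Λ linked C ε n ∧
      ((∃ i' < i, ¬ linked (Λ^[i'] j) (Λ^[i'] l)) →
        (influenceSeq Λ linked C ε (n + i)).2 j l ≤ K * totalInteraction Λ linked C ε n ^ 2) := by
  induction i with
  | zero =>
    refine ⟨1, le_rfl, fun ε n hε _ _ j l => ⟨?_, ?_⟩⟩
    · rw [one_mul]
      exact influenceSeq_snd_le_total hC hε n j l
    · rintro ⟨i, hi, -⟩
      omega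
  | succ i ih =>
    obtain ⟨K, hK, ih⟩ := ih
    set q : ℝ := (Fintype.card ι : ℝ) ^ 2 with hq
    have hq0 : 0 ≤ q := by positivity
    have hK' : K ≤ C * (K + q ^ 2 * K ^ 2) := by nlinarith [mul_nonneg (sq_nonneg q) (sq_nonneg K)]
    refine ⟨C * (K + q ^ 2 * K ^ 2), hK.trans hK', fun ε n hε hM hKM j l => ?_⟩
    set M := totalInteraction Λ linked C ε n with hMdef
    have hM0 : 0 ≤ M := totalInteraction_nonneg hC hε n
    have hKM' : K * M ≤ 1 := (mul_le_mul_of_nonneg_right hK' hM0).trans hKM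
    have ih' := ih ε n hε hM hKM'
    have htot : totalInteraction Λ linked C ε (n + i) ≤ q * (K * M) := by
      unfold totalInteraction
      calc _ ≤ ∑ _j : ι, ∑ _l : ι, K * M :=
            sum_le_sum fun j _ => sum_le_sum fun l _ => (ih' j l).1
        _ = q * (K * M) := by simp [hq]; ring
    have htot0 := totalInteraction_nonneg (Λ := Λ) (linked := linked) hC hε (n + i)
    have hsq : totalInteraction Λ linked C ε (n + i) ^ 2 ≤ q ^ 2 * K ^ 2 * M ^ 2 := by
      calc _ ≤ (q * (K * M)) ^ 2 := pow_le_pow_left₀ htot0 htot 2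
        _ = _ := by ring
    have hMM : M ^ 2 ≤ M := by nlinarith
    have hqK : 0 ≤ q ^ 2 * K ^ 2 := by positivity
    have e : (influenceSeq Λ linked C ε (n + (i + 1))).2 j l = C * ((if linked j l then
      (influenceSeq Λ linked C ε (n + i)).2 (Λ j) (Λ l) else 0) +
        totalInteraction Λ linked C ε (n + i) ^ 2) := rfl
    rw [e]
    constructor
    · rw [mul_assoc]
      refine mul_le_mul_of_nonneg_left ?_ (by linarith)
      have : (if linked j l then (influenceSeq Λ linked C ε (n + i)).2 (Λ j) (Λ l) else 0)
          ≤ K * M := by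
        split_ifs
        · exact (ih' _ _).1
        · positivity
      nlinarith [mul_le_mul_of_nonneg_left hMM hqK]
    · rintro ⟨i', hi', hl⟩
      rw [mul_assoc]
      refine mul_le_mul_of_nonneg_left ?_ (by linarith)
      have : (if linked j l then (influenceSeq Λ linked C ε (n + i)).2 (Λ j) (Λ l) else 0)
          ≤ K * M ^ 2 := by
        split_ifs with h
        · refine (ih' _ _).2 ⟨i' - 1, ?_, ?_⟩
          · rcases i' with _ | i'
            · exact absurd h hl
            · omega
          · rcases i' with _ | i'
            · exact absurd h hl
            · simpa using hl
        · positivity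
      linarith

theorem exists_iterate_mem_periodicPts (Λ : ι → ι) (j : ι) :
    ∃ r, Λ^[r] j ∈ Function.periodicPts Λ := by
  obtain ⟨m, n, hmn, h⟩ := Finite.exists_ne_map_eq_of_infinite fun r => Λ^[r] j
  wlog hlt : m < n generalizing m n
  · exact this n m hmn.symm h.symm (by omega)
  refine ⟨m, Function.mk_mem_periodicPts (n := n - m) (by omega) ?_⟩
  rw [Function.IsPeriodicPt, Function.IsFixedPt, ← Function.iterate_add_apply,
    Nat.sub_add_cancel hlt.le]
  exact h.symm

theorem sum_range_mul_half_pow_div (P : ℕ) (hP : 0 < P) (t : ℕ) :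
    ∑ m ∈ range (t * P), ((1 : ℝ) / 2) ^ (m / P) = P * (2 - 2 * (1 / 2) ^ t) := by
  induction t with
  | zero => simp
  | succ t ih =>
    rw [Nat.succ_mul, sum_range_add, ih]
    have : ∑ x ∈ range P, ((1 : ℝ) / 2) ^ ((t * P + x) / P) = ∑ x ∈ range P, (1 / 2) ^ t := by
      refine sum_congr rfl fun x hx => ?_
      rw [mul_comm, Nat.mul_add_div hP, Nat.div_eq_of_lt (mem_range.1 hx), add_zero]
    rw [this, sum_const, card_range, nsmul_eq_mul, pow_succ]
    ring

theorem sum_range_half_pow_div_le (P : ℕ) (hP : 0 < P) (n : ℕ) :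
    ∑ m ∈ range n, ((1 : ℝ) / 2) ^ (m / P) ≤ 2 * P := by
  calc _ ≤ ∑ m ∈ range (n * P), ((1 : ℝ) / 2) ^ (m / P) :=
        sum_le_sum_of_subset_of_nonneg (range_subset_range.2 (Nat.le_mul_of_pos_right n hP))
          fun _ _ _ => by positivity
    _ ≤ 2 * P := by
        rw [sum_range_mul_half_pow_div P hP]
        have : (0 : ℝ) ≤ P * (1 / 2) ^ n := by positivity
        linarith

/-- If all chains of pairs are eventually unlinked, the interactions are summable. -/
theorem exists_summable_interaction {N : ℕ}
    (hchain : ∀ j l, ∃ i < N, ¬ linked (Λ^[i] j) (Λ^[i] l)) (hC : 1 ≤ C) :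
    ∃ H : ℝ, ∃ ε₀ > 0, 1 ≤ H ∧ ∀ ε, 0 ≤ ε → ε ≤ ε₀ → ∀ n,
      totalInteraction Λ linked C ε n ≤ H * ε ∧
      ∑ m ∈ range n, totalInteraction Λ linked C ε m ≤ H * ε := by
  choose K' hK'1 hK' using exists_interaction_bound (C := C) Λ linked hC
  set P := N + 1 with hP
  set K := ∑ i ∈ range (P + 1), K' i with hKdef
  have hKi : ∀ i ≤ P, K' i ≤ K := fun i hi =>
    single_le_sum (f := K') (fun i _ => zero_le_one.trans (hK'1 i)) (mem_range.2 (by omega))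
  have hK1 : 1 ≤ K := (hK'1 0).trans (hKi 0 (by omega))
  set q : ℝ := (Fintype.card ι : ℝ) ^ 2 with hq
  have hq0 : 0 ≤ q := by positivity
  set D := (q + 1) * K with hD
  have hKD : K ≤ D := by nlinarith
  have hqKD : q * K ≤ D := by nlinarith
  have hD1 : 1 ≤ D := hK1.trans hKD
  have htot : ∀ (B : ℝ) (ε : ℝ) (n : ℕ), (∀ j l, (influenceSeq Λ linked C ε n).2 j l ≤ B) →
      totalInteraction Λ linked C ε n ≤ q * B := by
    intro B ε n h
    unfold totalInteraction
    calc _ ≤ ∑ _j : ι, ∑ _l : ι, B := sum_le_sum fun j _ => sum_le_sum fun l _ => h j l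
      _ = q * B := by simp [hq]; ring
  have hblock : ∀ ε n, 0 ≤ ε → D * totalInteraction Λ linked C ε n ≤ 1 →
      (∀ i ≤ P, totalInteraction Λ linked C ε (n + i) ≤ D * totalInteraction Λ linked C ε n) ∧
      totalInteraction Λ linked C ε (n + P) ≤ D * totalInteraction Λ linked C ε n ^ 2 := by
    intro ε n hε hM
    have hM0 := totalInteraction_nonneg (Λ := Λ) (linked := linked) hC hε n
    set M := totalInteraction Λ linked C ε n with hMdef
    have hM1 : M ≤ 1 := by nlinarith
    have hKM : ∀ i ≤ P, K' i * M ≤ 1 := fun i hi =>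
      (mul_le_mul_of_nonneg_right ((hKi i hi).trans hKD) hM0).trans hM
    refine ⟨fun i hi => ?_, ?_⟩
    · refine (htot (K * M) ε _ fun j l => ((hK' i ε n hε hM1 (hKM i hi) j l).1).trans
        (mul_le_mul_of_nonneg_right (hKi i hi) hM0)).trans ?_
      rw [← mul_assoc]
      exact mul_le_mul_of_nonneg_right hqKD hM0
    · refine (htot (K * M ^ 2) ε _ fun j l => ((hK' P ε n hε hM1 (hKM P le_rfl) j l).2 ?_).trans
        (mul_le_mul_of_nonneg_right (hKi P le_rfl) (sq_nonneg M))).trans ?_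
      · obtain ⟨i, hi, h⟩ := hchain j l
        exact ⟨i, by omega, h⟩
      · rw [← mul_assoc]
        exact mul_le_mul_of_nonneg_right hqKD (sq_nonneg M)
  have hPpos : (1 : ℝ) ≤ P := by rw [hP]; push_cast; linarith [Nat.cast_nonneg (α := ℝ) N]
  have hDq : 0 ≤ D * q := by positivity
  refine ⟨2 * P * (D * q) + 1, 1 / (2 * D * (q + 1)), by positivity, by nlinarith,
    fun ε hε hε0 => ?_⟩
  rw [le_div_iff₀ (by positivity)] at hε0
  have hsmall : D * (q * ε) ≤ 1 / 2 := by nlinarith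
  have hstep : ∀ t : ℕ, totalInteraction Λ linked C ε (t * P) ≤ q * ε * (1 / 2) ^ t := by
    intro t
    induction t with
    | zero =>
      rw [pow_zero, mul_one, Nat.zero_mul]
      exact htot ε ε 0 fun _ _ => le_rfl
    | succ t ih =>
      have hM0 := totalInteraction_nonneg (Λ := Λ) (linked := linked) hC hε (t * P)
      have hpow : ((1 : ℝ) / 2) ^ t ≤ 1 := pow_le_one₀ (by norm_num) (by norm_num)
      have hqε : 0 ≤ q * ε := by positivity
      have hM1 : totalInteraction Λ linked C ε (t * P) ≤ q * ε :=
        ih.trans (mul_le_of_le_one_right hqε hpow)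
      have hDM : D * totalInteraction Λ linked C ε (t * P) ≤ 1 / 2 :=
        (mul_le_mul_of_nonneg_left hM1 (by linarith)).trans hsmall
      rw [Nat.succ_mul]
      refine (hblock ε (t * P) hε (by linarith)).2.trans ?_
      have h1 := mul_le_mul_of_nonneg_right hDM hM0
      rw [sq, ← mul_assoc, pow_succ]
      linarith
  have hall : ∀ n, totalInteraction Λ linked C ε n ≤ D * q * ε * (1 / 2) ^ (n / P) := by
    intro n
    have h := hstep (n / P)
    have hqε : 0 ≤ q * ε := by positivity
    have hpow : ((1 : ℝ) / 2) ^ (n / P) ≤ 1 := pow_le_one₀ (by norm_num) (by norm_num)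
    have hM1 := h.trans (mul_le_of_le_one_right hqε hpow)
    have h2 := (hblock ε (n / P * P) hε (by nlinarith)).1 (n % P)
      (Nat.mod_lt n (by omega)).le
    rw [Nat.div_add_mod'] at h2
    refine h2.trans ?_
    nlinarith
  intro n
  constructor
  · refine (hall n).trans ?_
    have hpow : ((1 : ℝ) / 2) ^ (n / P) ≤ 1 := pow_le_one₀ (by norm_num) (by norm_num)
    have : 0 ≤ D * q * ε := by positivity
    nlinarith [mul_le_mul_of_nonneg_left hpow this]
  · calc _ ≤ ∑ m ∈ range n, D * q * ε * (1 / 2) ^ (m / P) := sum_le_sum fun m _ => hall m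
      _ = D * q * ε * ∑ m ∈ range n, (1 / 2) ^ (m / P) := (mul_sum ..).symm
      _ ≤ D * q * ε * (2 * P) :=
        mul_le_mul_of_nonneg_left (sum_range_half_pow_div_le P (by omega) n) (by positivity)
      _ ≤ _ := by linarith

theorem exists_influenceSeq_le {N : ℕ}
    (hchain : ∀ j l, ∃ i < N, ¬ linked (Λ^[i] j) (Λ^[i] l)) (hC : 1 ≤ C) {δ : ℝ} (hδ : 0 < δ) :
    ∃ ε > 0, ∀ n, (∀ j, (influenceSeq Λ linked C ε n).1 j ≤ δ) ∧
      totalInteraction Λ linked C ε n ≤ δ := by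
  obtain ⟨H, ε₀, hε₀, hH, hsum⟩ := exists_summable_interaction hchain hC
  have hper : ∀ ε, 0 ≤ ε → ∀ n, ∀ j ∈ Function.periodicPts Λ, (influenceSeq Λ linked C ε n).1 j ≤
      ε + C * ∑ m ∈ range n, totalInteraction Λ linked C ε m := by
    intro ε hε n
    induction n with
    | zero => simp [influenceSeq]
    | succ n ih =>
      intro j hj
      have h1 := ih (Λ j) (Function.bijOn_periodicPts Λ |>.mapsTo hj)
      have e : (influenceSeq Λ linked C ε (n + 1)).1 j =
          (influenceSeq Λ linked C ε n).1 (Λ j) + C * totalInteraction Λ linked C ε n := by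
        simp only [influenceSeq, if_pos hj, totalInteraction]
      rw [e, sum_range_succ]
      linarith
  have hrank : ∀ r : ℕ, ∃ K : ℝ, 1 ≤ K ∧ ∀ ε, 0 ≤ ε → ε ≤ ε₀ → ∀ j,
      Λ^[r] j ∈ Function.periodicPts Λ → ∀ n, (influenceSeq Λ linked C ε n).1 j ≤ K * ε := by
    intro r
    induction r with
    | zero =>
      refine ⟨1 + C * H, by nlinarith, fun ε hε hε0 j hj n => (hper ε hε n j hj).trans ?_⟩
      nlinarith [mul_le_mul_of_nonneg_left (hsum ε hε hε0 n).2 (by linarith : 0 ≤ C)]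
    | succ r ih =>
      obtain ⟨K, hK, ih⟩ := ih
      refine ⟨C * (K + H), by nlinarith, fun ε hε hε0 j hj n => ?_⟩
      rcases n with _ | n
      · exact le_mul_of_one_le_left hε (by nlinarith)
      · have h1 := ih ε hε hε0 (Λ j) hj n
        have h2 := (hsum ε hε hε0 n).1
        have h3 : (influenceSeq Λ linked C ε (n + 1)).1 j ≤
            C * ((influenceSeq Λ linked C ε n).1 (Λ j) + totalInteraction Λ linked C ε n) := by
          simp only [influenceSeq, totalInteraction]
          have h4 := influenceSeq_fst_nonneg (Λ := Λ) (linked := linked) hC hε n (Λ j)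
          split_ifs
          · nlinarith
          · exact le_rfl
        refine h3.trans ?_
        rw [mul_assoc]
        exact mul_le_mul_of_nonneg_left (by linarith) (by linarith)
  choose r hr using exists_iterate_mem_periodicPts Λ
  choose K hK1 hK using hrank
  set L := H + ∑ j, K (r j) with hL
  have hs0 : 0 ≤ ∑ j, K (r j) := sum_nonneg fun j _ => zero_le_one.trans (hK1 _)
  have hL1 : 1 ≤ L := by linarith
  have hε : 0 < min ε₀ (δ / L) := lt_min hε₀ (by positivity)
  have hεδ : L * min ε₀ (δ / L) ≤ δ := by
    rw [mul_comm, ← le_div_iff₀ (by linarith)]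
    exact min_le_right _ _
  refine ⟨min ε₀ (δ / L), hε, fun n => ⟨fun j => ?_, ?_⟩⟩
  · refine ((hK (r j) _ hε.le (min_le_left _ _) j (hr j) n).trans
      (mul_le_mul_of_nonneg_right ?_ hε.le)).trans hεδ
    have := single_le_sum (f := fun j => K (r j)) (fun j _ => zero_le_one.trans (hK1 _))
      (mem_univ j)
    linarith
  · refine ((hsum _ hε.le (min_le_left _ _) n).1.trans
      (mul_le_mul_of_nonneg_right ?_ hε.le)).trans hεδ
    linarith

end ScalarRecursion

section NatPolynomial

open Polynomial Filter Bornology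

theorem norm_aeval_nat_le (P : ℕ[X]) (z : ℂ) : ‖aeval z P‖ ≤ aeval ‖z‖ P := by
  rw [aeval_eq_sum_range, aeval_eq_sum_range]
  refine (norm_sum_le _ _).trans (le_of_eq (Finset.sum_congr rfl fun i _ => ?_))
  simp [nsmul_eq_mul]

theorem aeval_nat_le_mul_pow (P : ℕ[X]) {x : ℝ} (hx : 1 ≤ x) {d : ℕ} (hd : P.natDegree ≤ d) :
    aeval x P ≤ aeval (1 : ℝ) P * x ^ d := by
  rw [aeval_eq_sum_range, aeval_eq_sum_range, Finset.sum_mul]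
  refine Finset.sum_le_sum fun i hi => ?_
  rw [one_pow, nsmul_eq_mul, nsmul_eq_mul, mul_one]
  have hi' : i ≤ d := by
    have := Finset.mem_range.1 hi
    omega
  exact mul_le_mul_of_nonneg_left (pow_le_pow_right₀ hx hi') (Nat.cast_nonneg _)

/-- A polynomial with natural coefficients is dominated by its leading term near infinity. -/
theorem eventually_aeval_norm_le (P : ℕ[X]) :
    ∀ᶠ z : ℂ in cobounded ℂ, aeval ‖z‖ P ≤ 2 * ‖aeval z P‖ := by
  by_cases hP : P = 0
  · simp [hP]
  have h1 : ∀ᶠ z : ℂ in cobounded ℂ, max 1 (3 * aeval (1 : ℝ) P.eraseLead) ≤ ‖z‖ :=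
    tendsto_norm_cobounded_atTop.eventually_ge_atTop _
  filter_upwards [h1] with z hz
  have hz1 : 1 ≤ ‖z‖ := (le_max_left _ _).trans hz
  have hz3 : 3 * aeval (1 : ℝ) P.eraseLead ≤ ‖z‖ := (le_max_right _ _).trans hz
  set d := P.natDegree
  set L : ℝ := P.leadingCoeff * ‖z‖ ^ d with hL
  have hlc : (1 : ℝ) ≤ P.leadingCoeff := by
    exact_mod_cast Nat.one_le_iff_ne_zero.2 (leadingCoeff_ne_zero.2 hP)
  have hpow : ‖z‖ ^ d ≤ L := le_mul_of_one_le_left (by positivity) hlc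
  have he : 3 * aeval ‖z‖ P.eraseLead ≤ L := by
    rcases Nat.eq_zero_or_pos d with hd | hd
    · have : P.eraseLead = 0 := by
        rw [eq_C_of_natDegree_eq_zero hd, eraseLead_C]
      rw [this, map_zero, mul_zero]
      positivity
    · have h2 := aeval_nat_le_mul_pow P.eraseLead hz1 (d := d - 1) (eraseLead_natDegree_le P)
      have h3 : ‖z‖ ^ d = ‖z‖ * ‖z‖ ^ (d - 1) := by
        rw [← pow_succ', Nat.sub_add_cancel hd]
      have h4 := mul_le_mul_of_nonneg_right hz3 (by positivity : 0 ≤ ‖z‖ ^ (d - 1))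
      linarith
  have e1 : aeval ‖z‖ P = aeval ‖z‖ P.eraseLead + L := by
    conv_lhs => rw [← eraseLead_add_C_mul_X_pow P]
    simp [hL, d]
  have e2 : aeval z P = aeval z P.eraseLead + P.leadingCoeff * z ^ d := by
    conv_lhs => rw [← eraseLead_add_C_mul_X_pow P]
    simp [d]
  have h5 : L - aeval ‖z‖ P.eraseLead ≤ ‖aeval z P‖ := by
    have h6 := norm_sub_le (aeval z P) (aeval z P.eraseLead)
    have h7 : aeval z P - aeval z P.eraseLead = P.leadingCoeff * z ^ d := by rw [e2]; ring
    rw [h7, norm_mul, norm_pow, Complex.norm_natCast] at h6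
    linarith [norm_aeval_nat_le P.eraseLead z]
  linarith

theorem eventually_aeval_ne_zero {P : ℕ[X]} (hP : P ≠ 0) :
    ∀ᶠ z : ℂ in cobounded ℂ, aeval z P ≠ 0 := by
  have h1 : ∀ᶠ z : ℂ in cobounded ℂ, 1 ≤ ‖z‖ :=
    tendsto_norm_cobounded_atTop.eventually_ge_atTop _
  filter_upwards [eventually_aeval_norm_le P, h1] with z hz hz1 h0
  rw [h0, norm_zero, mul_zero, aeval_eq_sum_range] at hz
  have h2 : P.coeff P.natDegree • ‖z‖ ^ P.natDegree ≤
      ∑ i ∈ Finset.range (P.natDegree + 1), P.coeff i • ‖z‖ ^ i :=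
    Finset.single_le_sum (f := fun i => P.coeff i • ‖z‖ ^ i) (fun i _ => by positivity)
      (Finset.self_mem_range_succ _)
  have h3 : 0 < P.coeff P.natDegree • ‖z‖ ^ P.natDegree := by
    rw [nsmul_eq_mul]
    have : 0 < P.coeff P.natDegree := Nat.pos_of_ne_zero (leadingCoeff_ne_zero.2 hP)
    positivity
  linarith

theorem eventually_sum_norm_aeval_le {τ : Type*} (A : Finset τ) (P : τ → ℕ[X]) :
    ∀ᶠ z : ℂ in cobounded ℂ, ∑ t ∈ A, ‖aeval z (P t)‖ ≤ 2 * ‖∑ t ∈ A, aeval z (P t)‖ := by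
  filter_upwards [eventually_aeval_norm_le (∑ t ∈ A, P t)] with z hz
  rw [map_sum, map_sum] at hz
  exact (Finset.sum_le_sum fun t _ => norm_aeval_nat_le (P t) z).trans hz

end NatPolynomial

namespace GluingData

open Classical Polynomial Filter Bornology

variable {k : ℕ} (D : GluingData k)

theorem label_edgeAt (w : D.W) (j : Fin k) : D.label (D.edgeAt w j) = j :=
  (D.existsUnique_edge w j).choose_spec.1.2

theorem edgeAt_label {e : D.E} {w : D.W} (hw : w ∈ D.verts e) : D.edgeAt w (D.label e) = e :=
  ((D.existsUnique_edge w (D.label e)).choose_spec.2 e ⟨hw, rfl⟩).symm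

/-- The edge `e` is in the image of `Φ`, so that the root of `Σ_e` is marked. -/
def IsRooted (e : D.E) : Prop := ∃ j, D.Phi j = e

/-- A choice of a set of vertices in every connecting graph. -/
abbrev Conf : Type := ∀ e : D.E, Finset (D.conn e).V

/-- The number of unmarked vertices in `t`. -/
noncomputable def exponent (e : D.E) (t : Finset (D.conn e).V) : ℕ :=
  (t.filter fun v => ¬ (D.IsRooted e ∧ v = D.root e)).card

/-- `s` and `t` agree on the marked vertices of `Σ_e`. -/
def Match (e : D.E) (s t : Finset (D.conn e).V) : Prop :=
  D.IsRooted e → (D.root e ∈ s ↔ D.root e ∈ t)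

/-- The values that `t` induces on the marked vertices of the copy `G(w)`. -/
noncomputable def boundary (w : D.W) (t : D.Conf) : Fin k → Bool := fun j =>
  decide (D.attach (D.edgeAt w j) ⟨w, D.mem_verts_edgeAt w j⟩ ∈ t (D.edgeAt w j))

theorem boundary_label (t : D.Conf) {e : D.E} {w : D.W} (hw : w ∈ D.verts e) :
    D.boundary w t (D.label e) = decide (D.attach e ⟨w, hw⟩ ∈ t e) := by
  unfold boundary
  generalize_proofs p
  revert p
  rw [D.edgeAt_label hw]
  intro p
  rfl

theorem boundary_update_of_mem (t : D.Conf) {e : D.E} {w : D.W} (hw : w ∈ D.verts e)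
    (u : Finset (D.conn e).V) :
    D.boundary w (Function.update t e u) =
      Function.update (D.boundary w t) (D.label e) (decide (D.attach e ⟨w, hw⟩ ∈ u)) := by
  funext j
  by_cases hj : j = D.label e
  · subst hj
    rw [D.boundary_label _ hw, Function.update_self, Function.update_self]
  · rw [Function.update_of_ne hj]
    have : D.edgeAt w j ≠ e := fun h => hj (by rw [← h, D.label_edgeAt])
    unfold boundary
    rw [Function.update_of_ne this]

theorem boundary_update_of_notMem (t : D.Conf) {e : D.E} {w : D.W} (hw : w ∉ D.verts e)
    (u : Finset (D.conn e).V) : D.boundary w (Function.update t e u) = D.boundary w t := by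
  funext j
  have : D.edgeAt w j ≠ e := fun h => hw (by rw [← h]; exact D.mem_verts_edgeAt w j)
  unfold boundary
  rw [Function.update_of_ne this]

/-- The contribution of the choice `t` in `Σ_e`, when every marked vertex labeled `j` that is glued
to `Σ_e` carries the weight `c j`. -/
noncomputable def weight (c : Fin k → Bool → ℕ[X]) (e : D.E) (t : Finset (D.conn e).V) : ℕ[X] :=
  if (D.conn e).IsIndep t then
    X ^ D.exponent e t * ∏ w : {w // w ∈ D.verts e}, c (D.label e) (decide (D.attach e w ∈ t))
  else 0

noncomputable def normPoly (c : Fin k → Bool → ℕ[X]) (e : D.E) (s : Finset (D.conn e).V) : ℕ[X] :=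
  ∑ t with D.Match e s t, D.weight c e t

noncomputable def refStep (c : Fin k → Bool → ℕ[X]) (j : Fin k) (x : Bool) : ℕ[X] :=
  ∑ t with (D.root (D.Phi j) ∈ t ↔ x = true), D.weight c (D.Phi j) t

/-- The factors of the partition function of a product state after `n` steps. -/
noncomputable def refSeq : ℕ → Fin k → Bool → ℕ[X]
  | 0 => fun _ _ => 1
  | n + 1 => D.refStep (refSeq n)

theorem isIndep_empty (G : Multigraph) : G.IsIndep ∅ := by
  intro e _ h
  induction e with
  | _ a b => exact absurd (h a (Sym2.mem_mk_left a b)) (Finset.notMem_empty a)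

theorem eval_weight_empty_pos {c : Fin k → Bool → ℕ[X]} (hc : ∀ j, 0 < (c j false).eval 1)
    (e : D.E) : 0 < (D.weight c e ∅).eval 1 := by
  unfold weight
  rw [if_pos (isIndep_empty _)]
  simp only [Finset.notMem_empty, decide_false, eval_mul, eval_pow, eval_X, one_pow, one_mul,
    eval_prod]
  exact Finset.prod_pos fun _ _ => hc _

theorem eval_sum_pos {τ : Type*} {A : Finset τ} {P : τ → ℕ[X]} {t : τ} (ht : t ∈ A)
    (h : 0 < (P t).eval 1) : 0 < (∑ t ∈ A, P t).eval 1 := by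
  rw [eval_finsetSum]
  exact h.trans_le (Finset.single_le_sum (f := fun t => (P t).eval 1) (fun _ _ => Nat.zero_le _) ht)

theorem eval_refSeq_pos (n : ℕ) (j : Fin k) : 0 < (D.refSeq n j false).eval 1 := by
  induction n generalizing j with
  | zero => simp [refSeq]
  | succ n ih =>
    exact eval_sum_pos (t := ∅) (by simp) (D.eval_weight_empty_pos ih _)

theorem normPoly_ne_zero {e : D.E} (he : ¬ D.IsRooted e) (n : ℕ) (s : Finset (D.conn e).V) :
    D.normPoly (D.refSeq n) e s ≠ 0 := by
  intro h0
  have : 0 < (D.normPoly (D.refSeq n) e s).eval 1 :=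
    eval_sum_pos (t := ∅) (by simp [Match, he]) (D.eval_weight_empty_pos (D.eval_refSeq_pos n) e)
  simp [h0] at this

theorem finset_ext_of_card_eq_one {V : Type*} [Fintype V] (h : Fintype.card V = 1) {v : V}
    {s t : Finset V} (hst : v ∈ s ↔ v ∈ t) : s = t := by
  have := Fintype.card_le_one_iff_subsingleton.1 h.le
  ext u
  rw [Subsingleton.elim u v, hst]

theorem refStep_of_periodic (hstable : D.IsStable) {j : Fin k}
    (hj : j ∈ Function.periodicPts D.labelMap) (c : Fin k → Bool → ℕ[X]) :
    D.refStep c j = c (D.labelMap j) := by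
  funext x
  obtain ⟨hcard, hedges⟩ := hstable.2 j hj
  have hverts : (D.verts (D.Phi j)).card = 1 := by
    have h1 := hstable.1 j hj
    have h2 := (D.verts_nonempty (D.Phi j)).card_pos
    unfold IsCritical at h1
    omega
  set t₀ : Finset (D.conn (D.Phi j)).V := if x = true then {D.root (D.Phi j)} else ∅ with ht₀
  have hroot : D.root (D.Phi j) ∈ t₀ ↔ x = true := by
    rw [ht₀]
    split_ifs with h <;> simp [h]
  have hset : (Finset.univ.filter fun t => (D.root (D.Phi j) ∈ t ↔ x = true)) = {t₀} := by
    ext t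
    rw [Finset.mem_filter, Finset.mem_singleton]
    constructor
    · rintro ⟨-, h⟩
      exact finset_ext_of_card_eq_one hcard (h.trans hroot.symm)
    · rintro rfl
      exact ⟨Finset.mem_univ _, hroot⟩
  have hsub := Fintype.card_le_one_iff_subsingleton.1 hcard.le
  have hdec : ∀ v, decide (v ∈ t₀) = x := fun v => by
    rw [Subsingleton.elim v (D.root (D.Phi j)), Bool.eq_iff_iff, decide_eq_true_iff, hroot]
  have hexp : D.exponent (D.Phi j) t₀ = 0 := by
    unfold exponent
    rw [Finset.card_eq_zero, Finset.filter_eq_empty_iff]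
    intro v _ h
    exact h ⟨⟨j, rfl⟩, Subsingleton.elim _ _⟩
  unfold refStep weight
  rw [hset, Finset.sum_singleton, if_pos, hexp]
  · simp only [hdec]
    rw [Finset.prod_const, Finset.card_univ, Fintype.card_coe, hverts, pow_zero, one_mul, pow_one]
    rfl
  · intro e he
    rw [hedges] at he
    simp at he

theorem refSeq_of_periodic (hstable : D.IsStable) (n : ℕ) {j : Fin k}
    (hj : j ∈ Function.periodicPts D.labelMap) : D.refSeq n j = fun _ => 1 := by
  induction n generalizing j with
  | zero => rfl
  | succ n ih =>
    exact (D.refStep_of_periodic hstable hj _).trans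
      (ih ((Function.bijOn_periodicPts D.labelMap).mapsTo hj))

theorem refStep_congr {c c' : Fin k → Bool → ℕ[X]} {j : Fin k}
    (h : c (D.labelMap j) = c' (D.labelMap j)) : D.refStep c j = D.refStep c' j := by
  funext x
  unfold refStep weight
  have h' : c (D.label (D.Phi j)) = c' (D.label (D.Phi j)) := h
  rw [h']

theorem refSeq_eq_of_le (hstable : D.IsStable) (r : ℕ) {j : Fin k}
    (hj : D.labelMap^[r] j ∈ Function.periodicPts D.labelMap) {n : ℕ} (hn : r ≤ n) :
    D.refSeq n j = D.refSeq r j := by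
  induction r generalizing j n with
  | zero =>
    rw [D.refSeq_of_periodic hstable n (j := j) hj, D.refSeq_of_periodic hstable 0 (j := j) hj]
  | succ r ih =>
    obtain ⟨n, rfl⟩ : ∃ m, n = m + 1 := ⟨n - 1, by omega⟩
    exact D.refStep_congr (ih hj (by omega))

theorem exists_refSeq_eq (hstable : D.IsStable) : ∃ N, ∀ n, ∃ m ≤ N, D.refSeq n = D.refSeq m := by
  choose r hr using exists_iterate_mem_periodicPts D.labelMap
  have hle : ∀ j, r j ≤ ∑ j, r j := fun j =>
    Finset.single_le_sum (fun _ _ => Nat.zero_le _) (Finset.mem_univ j)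
  refine ⟨∑ j, r j, fun n => ?_⟩
  rcases le_total n (∑ j, r j) with h | h
  · exact ⟨n, h, rfl⟩
  · refine ⟨_, le_rfl, funext fun j => ?_⟩
    rw [D.refSeq_eq_of_le hstable (r j) (hr j) ((hle j).trans h),
      D.refSeq_eq_of_le hstable (r j) (hr j) (hle j)]

/-- Since there are finitely many reference states, a property that holds near infinity for each of
them holds uniformly. -/
theorem eventually_forall_refSeq (hstable : D.IsStable) {p : (Fin k → Bool → ℕ[X]) → ℂ → Prop}
    (h : ∀ n, ∀ᶠ z in cobounded ℂ, p (D.refSeq n) z) :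
    ∀ᶠ z in cobounded ℂ, ∀ n, p (D.refSeq n) z := by
  obtain ⟨N, hN⟩ := D.exists_refSeq_eq hstable
  have : ∀ᶠ z in cobounded ℂ, ∀ m ∈ Finset.range (N + 1), p (D.refSeq m) z :=
    (eventually_all_finset _).2 fun m _ => h m
  filter_upwards [this] with z hz n
  obtain ⟨m, hm, e⟩ := hN n
  rw [e]
  exact hz m (Finset.mem_range.2 (by omega))

/-- The complex kernel on the vertex sets of `Σ_e` given by the weights `c` at fugacity `z`. -/
noncomputable def kernel (c : Fin k → Bool → ℕ[X]) (z : ℂ) (e : D.E)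
    (s t : Finset (D.conn e).V) : ℂ :=
  if aeval z (D.normPoly c e s) = 0 then if s = t then 1 else 0
  else (if D.Match e s t then aeval z (D.weight c e t) else 0) / aeval z (D.normPoly c e s)

/-- No cancellation occurs among the weights at `z`. -/
def IsDominated (c : Fin k → Bool → ℕ[X]) (z : ℂ) : Prop :=
  ∀ e (s : Finset (D.conn e).V), (∑ t with D.Match e s t, ‖aeval z (D.weight c e t)‖) ≤
    2 * ‖aeval z (D.normPoly c e s)‖

variable {D} {c : Fin k → Bool → ℕ[X]} {z : ℂ}

theorem sum_kernel (e : D.E) (s : Finset (D.conn e).V) : ∑ t, D.kernel c z e s t = 1 := by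
  unfold kernel
  by_cases h : aeval z (D.normPoly c e s) = 0
  · simp [h]
  · simp only [if_neg h]
    rw [← Finset.sum_div, ← Finset.sum_filter, div_eq_one_iff_eq h, normPoly, map_sum]

theorem sum_norm_kernel_le (hz : D.IsDominated c z) (e : D.E) (s : Finset (D.conn e).V) :
    ∑ t, ‖D.kernel c z e s t‖ ≤ 2 := by
  unfold kernel
  by_cases h : aeval z (D.normPoly c e s) = 0
  · simp only [h, if_true]
    simp [apply_ite norm]
  · simp only [if_neg h, norm_div]
    rw [← Finset.sum_div, div_le_iff₀ (norm_pos_iff.2 h)]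
    simp only [apply_ite norm, norm_zero]
    rw [← Finset.sum_filter]
    exact hz e s

theorem normPoly_mul_kernel (hz : D.IsDominated c z) (e : D.E) (s t : Finset (D.conn e).V) :
    aeval z (D.normPoly c e s) * D.kernel c z e s t =
      if D.Match e s t then aeval z (D.weight c e t) else 0 := by
  unfold kernel
  by_cases h : aeval z (D.normPoly c e s) = 0
  · rw [h, zero_mul]
    split_ifs with hm
    · have h1 := hz e s
      rw [h, norm_zero, mul_zero] at h1
      have h2 := Finset.single_le_sum (f := fun t => ‖aeval z (D.weight c e t)‖)
        (fun _ _ => norm_nonneg _) (Finset.mem_filter.2 ⟨Finset.mem_univ t, hm⟩)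
      exact (norm_le_zero_iff.1 (h2.trans h1)).symm
    · rfl
  · rw [if_neg h, mul_div_cancel₀ _ h]

theorem kernel_of_periodic (hstable : D.IsStable) {j : Fin k}
    (hj : j ∈ Function.periodicPts D.labelMap) (s t : Finset (D.conn (D.Phi j)).V) :
    D.kernel c z (D.Phi j) s t = if s = t then 1 else 0 := by
  have hcard := (hstable.2 j hj).1
  have hmatch : ∀ u, D.Match (D.Phi j) s u ↔ s = u := fun u =>
    ⟨fun h => finset_ext_of_card_eq_one hcard (h ⟨j, rfl⟩), fun h _ => by rw [h]⟩
  unfold kernel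
  by_cases h : aeval z (D.normPoly c (D.Phi j) s) = 0
  · rw [if_pos h]
  · rw [if_neg h]
    by_cases hst : s = t
    · subst hst
      have e : D.normPoly c (D.Phi j) s = D.weight c (D.Phi j) s := by
        unfold normPoly
        simp only [hmatch]
        rw [Finset.sum_filter, Finset.sum_ite_eq]
        simp
      rw [if_pos ((hmatch s).2 rfl), ← e, div_self h, if_pos rfl]
    · rw [if_neg (fun hm => hst ((hmatch t).1 hm)), zero_div, if_neg hst]

theorem eventually_isDominated (hstable : D.IsStable) :
    ∀ᶠ z in cobounded ℂ, ∀ n, D.IsDominated (D.refSeq n) z := by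
  refine D.eventually_forall_refSeq hstable fun n => ?_
  refine eventually_all.2 fun e => eventually_all.2 fun s => ?_
  filter_upwards [eventually_sum_norm_aeval_le (Finset.univ.filter fun t => D.Match e s t)
    (fun t => D.weight (D.refSeq n) e t)] with z hz
  rwa [normPoly, map_sum]

end GluingData

namespace MarkedGraph

open Classical

variable {k : ℕ} (G : MarkedGraph k)

noncomputable def numUnmarked (I : Finset G.V) : ℕ :=
  (I.filter fun v => ¬ ∃ j, G.mark j = v).card

/-- The partition function with prescribed values `x` on the marked vertices, in which marked
vertices are not counted. -/
noncomputable def partition (z : ℂ) (x : Fin k → Bool) : ℂ :=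
  ∑ I with G.IsIndep I ∧ G.Agrees x I, z ^ G.numUnmarked I

theorem agrees_iff {x : Fin k → Bool} {I : Finset G.V} :
    G.Agrees x I ↔ (fun j => decide (G.mark j ∈ I)) = x := by
  simp only [Agrees, funext_iff]
  refine forall_congr' fun j => ?_
  cases x j <;> simp

theorem Agrees.card_eq {G : MarkedGraph k} {x : Fin k → Bool} {I : Finset G.V}
    (h : G.Agrees x I) :
    I.card = (Finset.univ.filter fun j => x j = true).card + G.numUnmarked I := by
  rw [numUnmarked, ← Finset.card_filter_add_card_filter_not (s := I) fun v => ∃ j, G.mark j = v]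
  congr 1
  rw [← Finset.card_image_of_injective _ G.mark_injective]
  congr 1
  ext v
  simp only [Finset.mem_filter, Finset.mem_image, Finset.mem_univ, true_and]
  constructor
  · rintro ⟨hv, j, rfl⟩
    exact ⟨j, (h j).1 hv, rfl⟩
  · rintro ⟨j, hj, rfl⟩
    exact ⟨(h j).2 hj, j, rfl⟩

theorem eval_indepPoly (z : ℂ) : G.indepPoly.eval z =
    ∑ x, z ^ (Finset.univ.filter fun j => x j = true).card * G.partition z x := by
  unfold Multigraph.indepPoly partition
  rw [Polynomial.eval_finsetSum,
    ← Finset.sum_fiberwise _ fun I j => decide (G.mark j ∈ I)]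
  refine Finset.sum_congr rfl fun x _ => ?_
  rw [Finset.mul_sum, Finset.filter_filter]
  simp only [← G.agrees_iff]
  refine Finset.sum_congr rfl fun I hI => ?_
  rw [Polynomial.eval_pow, Polynomial.eval_X, ← pow_add,
    Agrees.card_eq (Finset.mem_filter.1 hI).2.2]

end MarkedGraph

namespace GluingData

open Classical Polynomial

variable {k : ℕ} (D : GluingData k) (G : MarkedGraph k)

theorem copyMap_mark_eq (w : D.W) (j : Fin k) : D.copyMap G w (G.mark j) =
    Sum.inr ⟨D.edgeAt w j, D.attach _ ⟨w, D.mem_verts_edgeAt w j⟩⟩ := by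
  have h := D.copyMap_mark G (D.edgeAt w j) w (D.mem_verts_edgeAt w j)
  rwa [D.label_edgeAt] at h

theorem copyMap_unmarked (w : D.W) {v : G.V} (h : ¬ ∃ j, G.mark j = v) :
    D.copyMap G w v = Sum.inl (w, ⟨v, h⟩) :=
  dif_neg h

/-- The part of `I` in the connecting graphs. -/
noncomputable def connPart (I : Finset (D.RecVertex G)) : D.Conf := fun e =>
  Finset.univ.filter fun v => (Sum.inr ⟨e, v⟩ : D.RecVertex G) ∈ I

/-- The part of `I` in the copy `G(w)`. -/
noncomputable def copyPart (I : Finset (D.RecVertex G)) (w : D.W) : Finset G.V :=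
  Finset.univ.filter fun v => D.copyMap G w v ∈ I

noncomputable def assemble (t : D.Conf) (J : D.W → Finset G.V) : Finset (D.RecVertex G) :=
  Finset.univ.filter fun u => Sum.elim (fun p => p.2.1 ∈ J p.1) (fun q => q.2 ∈ t q.1) u

/-- The vertex sets of the connecting graphs that contain only marked roots, as prescribed by `y`. -/
noncomputable def rootConf (y : Fin k → Bool) : D.Conf := fun e =>
  if ∃ j, D.Phi j = e ∧ y j = true then {D.root e} else ∅

variable {D G}

@[simp] theorem mem_connPart {I : Finset (D.RecVertex G)} {e : D.E} {v : (D.conn e).V} :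
    v ∈ D.connPart G I e ↔ Sum.inr ⟨e, v⟩ ∈ I := by
  simp [connPart]

@[simp] theorem mem_copyPart {I : Finset (D.RecVertex G)} {w : D.W} {v : G.V} :
    v ∈ D.copyPart G I w ↔ D.copyMap G w v ∈ I := by
  simp [copyPart]

@[simp] theorem inl_mem_assemble {t : D.Conf} {J : D.W → Finset G.V} {w : D.W}
    {v : {v : G.V // ¬ ∃ j, G.mark j = v}} :
    (Sum.inl (w, v) : D.RecVertex G) ∈ D.assemble G t J ↔ v.1 ∈ J w := by
  simp [assemble]

@[simp] theorem inr_mem_assemble {t : D.Conf} {J : D.W → Finset G.V} {e : D.E}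
    {v : (D.conn e).V} : (Sum.inr ⟨e, v⟩ : D.RecVertex G) ∈ D.assemble G t J ↔ v ∈ t e := by
  simp [assemble]

theorem root_mem_rootConf {y : Fin k → Bool} {j : Fin k} :
    D.root (D.Phi j) ∈ D.rootConf y (D.Phi j) ↔ y j = true := by
  unfold rootConf
  split_ifs with h
  · obtain ⟨l, hl, hy⟩ := h
    rw [← D.Phi_injective hl]
    simp [hy]
  · simp only [Finset.notMem_empty, false_iff]
    exact fun hy => h ⟨j, rfl, hy⟩

theorem recursion_isIndep_iff {I : Finset (D.RecVertex G)} :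
    (D.recursion G).IsIndep I ↔
      (∀ w, G.IsIndep (D.copyPart G I w)) ∧ ∀ e, (D.conn e).IsIndep (D.connPart G I e) := by
  have hmap : ∀ {α : Type} (f : α → D.RecVertex G) (a : Sym2 α),
      (∀ v ∈ Sym2.map f a, v ∈ I) ↔ ∀ v ∈ a, f v ∈ I := by
    intro α f a
    constructor
    · exact fun h v hv => h _ (Sym2.mem_map.2 ⟨v, hv, rfl⟩)
    · intro h v hv
      obtain ⟨u, hu, rfl⟩ := Sym2.mem_map.1 hv
      exact h u hu
  constructor
  · intro h
    refine ⟨fun w a ha hI => ?_, fun e a ha hI => ?_⟩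
    · refine h (Sym2.map (D.copyMap G w) a) ?_ ((hmap _ a).2 fun v hv => mem_copyPart.1 (hI v hv))
      exact Multiset.mem_add.2 (Or.inl (Multiset.mem_sum.2
        ⟨w, Finset.mem_univ _, Multiset.mem_map.2 ⟨a, ha, rfl⟩⟩))
    · refine h (Sym2.map (fun v => Sum.inr ⟨e, v⟩) a) ?_
        ((hmap _ a).2 fun v hv => mem_connPart.1 (hI v hv))
      exact Multiset.mem_add.2 (Or.inr (Multiset.mem_sum.2
        ⟨e, Finset.mem_univ _, Multiset.mem_map.2 ⟨a, ha, rfl⟩⟩))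
  · rintro ⟨h1, h2⟩ a ha hI
    rcases Multiset.mem_add.1 ha with ha | ha
    · obtain ⟨w, -, ha⟩ := Multiset.mem_sum.1 ha
      obtain ⟨a, ha', rfl⟩ := Multiset.mem_map.1 ha
      exact h1 w a ha' fun v hv => mem_copyPart.2 ((hmap _ a).1 hI v hv)
    · obtain ⟨e, -, ha⟩ := Multiset.mem_sum.1 ha
      obtain ⟨a, ha', rfl⟩ := Multiset.mem_map.1 ha
      exact h2 e a ha' fun v hv => mem_connPart.2 ((hmap _ a).1 hI v hv)

theorem recursion_agrees_iff {y : Fin k → Bool} {I : Finset (D.RecVertex G)} :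
    (D.recursion G).Agrees y I ↔ ∀ e, D.Match e (D.rootConf y e) (D.connPart G I e) := by
  constructor
  · rintro h e ⟨j, rfl⟩
    rw [root_mem_rootConf, mem_connPart]
    exact (h j).symm
  · intro h j
    have := h (D.Phi j) ⟨j, rfl⟩
    rw [root_mem_rootConf, mem_connPart] at this
    exact this.symm

theorem agrees_boundary_copyPart (I : Finset (D.RecVertex G)) (w : D.W) :
    G.Agrees (D.boundary w (D.connPart G I)) (D.copyPart G I w) := by
  intro j
  rw [mem_copyPart, D.copyMap_mark_eq, boundary, decide_eq_true_iff, mem_connPart]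

theorem recursion_marked_iff {e : D.E} {v : (D.conn e).V} :
    (∃ j, (D.recursion G).mark j = (Sum.inr ⟨e, v⟩ : D.RecVertex G)) ↔
      D.IsRooted e ∧ v = D.root e := by
  constructor
  · rintro ⟨j, hj⟩
    have h := Sum.inr_injective hj
    obtain rfl : D.Phi j = e := congrArg Sigma.fst h
    exact ⟨⟨j, rfl⟩, (eq_of_heq (Sigma.mk.inj h).2).symm⟩
  · rintro ⟨⟨j, rfl⟩, rfl⟩
    exact ⟨j, rfl⟩

theorem card_filter_eq_sum_ite {α : Type*} [Fintype α] (I : Finset α) (p : α → Prop)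
    [DecidablePred p] [∀ u, Decidable (u ∈ I ∧ p u)] :
    (I.filter p).card = ∑ u, if u ∈ I ∧ p u then 1 else 0 := by
  rw [← Finset.card_filter]
  congr 1
  ext u
  simp

theorem recursion_numUnmarked (I : Finset (D.RecVertex G)) :
    (D.recursion G).numUnmarked I =
      ∑ e, D.exponent e (D.connPart G I e) + ∑ w, G.numUnmarked (D.copyPart G I w) := by
  have e1 : (D.recursion G).numUnmarked I = ∑ u : D.RecVertex G,
      if u ∈ I ∧ ¬ ∃ j, (D.recursion G).mark j = u then 1 else 0 := by
    exact (card_filter_eq_sum_ite (α := (D.recursion G).V) I _).trans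
      (Finset.sum_congr rfl fun u _ => by congr)
  rw [e1, Fintype.sum_sum_type, Fintype.sum_prod_type, Fintype.sum_sigma, add_comm]
  congr 1
  · refine Finset.sum_congr rfl fun e _ => ?_
    rw [exponent, ← Finset.card_filter]
    congr 1
    ext v
    simp only [Finset.mem_filter, Finset.mem_univ, true_and, recursion_marked_iff, mem_connPart]
  · refine Finset.sum_congr rfl fun w _ => ?_
    have e2 : G.numUnmarked (D.copyPart G I w) =
        ∑ v with ¬ ∃ j, G.mark j = v, if D.copyMap G w v ∈ I then 1 else 0 := by
      rw [MarkedGraph.numUnmarked, ← Finset.card_filter, Finset.filter_filter]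
      congr 1
      ext v
      simp [and_comm]
    rw [e2, Finset.sum_subtype (p := fun v => ¬ ∃ j, G.mark j = v) _ (by simp)]
    refine Finset.sum_congr rfl fun v _ => ?_
    rw [D.copyMap_unmarked G w v.2]
    refine if_congr (and_iff_left ?_) rfl rfl
    rintro ⟨j, hj⟩
    exact Sum.inr_ne_inl hj

theorem connPart_assemble (t : D.Conf) (J : D.W → Finset G.V) :
    D.connPart G (D.assemble G t J) = t := by
  funext e
  ext v
  simp

theorem copyPart_assemble {t : D.Conf} {J : D.W → Finset G.V}
    (h : ∀ w, G.Agrees (D.boundary w t) (J w)) : D.copyPart G (D.assemble G t J) = J := by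
  funext w
  ext v
  rw [mem_copyPart]
  by_cases hv : ∃ j, G.mark j = v
  · obtain ⟨j, rfl⟩ := hv
    rw [D.copyMap_mark_eq, inr_mem_assemble, h w j, boundary, decide_eq_true_iff]
  · rw [D.copyMap_unmarked G w hv, inl_mem_assemble]

theorem assemble_parts (I : Finset (D.RecVertex G)) :
    D.assemble G (D.connPart G I) (D.copyPart G I) = I := by
  ext u
  rcases u with ⟨w, v⟩ | ⟨e, v⟩
  · rw [inl_mem_assemble, mem_copyPart, D.copyMap_unmarked G w v.2]
  · rw [inr_mem_assemble, mem_connPart]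

theorem recursion_partition (z : ℂ) (y : Fin k → Bool) :
    (D.recursion G).partition z y = ∑ t : D.Conf,
      (∏ e, if D.Match e (D.rootConf y e) (t e) ∧ (D.conn e).IsIndep (t e) then
        z ^ D.exponent e (t e) else 0) * ∏ w, G.partition z (D.boundary w t) := by
  simp only [Finset.prod_ite_zero, ite_mul, zero_mul]
  rw [← Finset.sum_filter]
  simp only [MarkedGraph.partition, Finset.prod_univ_sum, Finset.mul_sum]
  rw [Finset.sum_sigma']
  refine Finset.sum_bij' (fun I _ => ⟨D.connPart G I, D.copyPart G I⟩)
    (fun p _ => D.assemble G p.1 p.2) ?_ ?_ ?_ ?_ ?_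
  · intro I hI
    obtain ⟨-, hI, hy⟩ := Finset.mem_filter.1 hI
    have hI := recursion_isIndep_iff.1 hI
    have hy := recursion_agrees_iff.1 hy
    refine Finset.mem_sigma.2 ⟨Finset.mem_filter.2 ⟨Finset.mem_univ _, fun e _ => ⟨hy e, hI.2 e⟩⟩,
      Fintype.mem_piFinset.2 fun w => Finset.mem_filter.2 ⟨Finset.mem_univ _, hI.1 w, ?_⟩⟩
    exact agrees_boundary_copyPart I w
  · rintro ⟨t, J⟩ hp
    obtain ⟨ht, hJ⟩ := Finset.mem_sigma.1 hp
    obtain ⟨-, ht⟩ := Finset.mem_filter.1 ht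
    have hJ' := fun w => (Finset.mem_filter.1 (Fintype.mem_piFinset.1 hJ w)).2
    refine Finset.mem_filter.2 ⟨Finset.mem_univ _, ?_, ?_⟩
    · rw [recursion_isIndep_iff, copyPart_assemble fun w => (hJ' w).2, connPart_assemble]
      exact ⟨fun w => (hJ' w).1, fun e => (ht e (Finset.mem_univ _)).2⟩
    · rw [recursion_agrees_iff, connPart_assemble]
      exact fun e => (ht e (Finset.mem_univ _)).1
  · intro I _
    exact assemble_parts I
  · rintro ⟨t, J⟩ hp
    obtain ⟨-, hJ⟩ := Finset.mem_sigma.1 hp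
    have hJ' := fun w => (Finset.mem_filter.1 (Fintype.mem_piFinset.1 hJ w)).2
    simp only [connPart_assemble, copyPart_assemble fun w => (hJ' w).2]
  · intro I _
    refine (congrArg (z ^ ·) (recursion_numUnmarked I)).trans ?_
    rw [pow_add, Finset.prod_pow_eq_pow_sum, Finset.prod_pow_eq_pow_sum]

end GluingData

namespace GluingData

open Classical Polynomial Filter Bornology Function

variable {k : ℕ} {D : GluingData k} {c : Fin k → Bool → ℕ[X]} {z : ℂ}

/-- The product state with factors `c`. -/
noncomputable def refState (c : Fin k → Bool → ℕ[X]) (z : ℂ) (x : Fin k → Bool) : ℂ :=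
  ∏ j, aeval z (c j (x j))

theorem prod_refState_boundary (t : D.Conf) :
    ∏ w, refState c z (D.boundary w t) =
      ∏ e, ∏ w : {w // w ∈ D.verts e}, aeval z (c (D.label e) (decide (D.attach e w ∈ t e))) := by
  unfold refState
  rw [← Fintype.prod_prod_type' (f := fun w j => aeval z (c j (D.boundary w t j))),
    ← Fintype.prod_sigma' (f := fun e (w : {w // w ∈ D.verts e}) =>
      aeval z (c (D.label e) (decide (D.attach e w ∈ t e))))]
  symm
  refine Fintype.prod_bijective (fun p => (p.2.1, D.label p.1)) ⟨?_, ?_⟩ _ _ ?_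
  · rintro ⟨e, w, hw⟩ ⟨e', w', hw'⟩ h
    obtain ⟨rfl, hl⟩ := Prod.mk.inj h
    have : e = e' := by rw [← D.edgeAt_label hw, ← D.edgeAt_label hw', hl]
    subst this
    rfl
  · rintro ⟨w, j⟩
    exact ⟨⟨D.edgeAt w j, w, D.mem_verts_edgeAt w j⟩, Prod.ext rfl (D.label_edgeAt w j)⟩
  · rintro ⟨e, w, hw⟩
    simp only
    rw [D.boundary_label t hw]

theorem aeval_weight (e : D.E) (t : Finset (D.conn e).V) : aeval z (D.weight c e t) =
    if (D.conn e).IsIndep t then z ^ D.exponent e t *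
      ∏ w : {w // w ∈ D.verts e}, aeval z (c (D.label e) (decide (D.attach e w ∈ t))) else 0 := by
  unfold weight
  split_ifs <;> simp

theorem normPoly_rootConf (y : Fin k → Bool) (j : Fin k) :
    D.normPoly c (D.Phi j) (D.rootConf y (D.Phi j)) = D.refStep c j (y j) := by
  unfold normPoly refStep
  congr 1
  ext t
  simp only [Finset.mem_filter, Finset.mem_univ, true_and]
  constructor
  · intro h
    rw [← root_mem_rootConf (D := D)]
    exact (h ⟨j, rfl⟩).symm
  · intro h _
    rw [root_mem_rootConf, h]

theorem prod_normPoly_rootConf (y : Fin k → Bool) :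
    ∏ e, aeval z (D.normPoly c e (D.rootConf y e)) =
      (∏ e with ¬ D.IsRooted e, aeval z (D.normPoly c e ∅)) * refState (D.refStep c) z y := by
  rw [← Finset.prod_filter_not_mul_prod_filter (p := D.IsRooted)]
  congr 1
  · refine Finset.prod_congr rfl fun e he => ?_
    have he' := (Finset.mem_filter.1 he).2
    have : D.rootConf y e = ∅ := if_neg fun ⟨j, hj, _⟩ => he' ⟨j, hj⟩
    rw [this]
  · have : Finset.univ.filter D.IsRooted = Finset.univ.image D.Phi := by
      ext e
      simp [IsRooted]
    rw [this, Finset.prod_image fun _ _ _ _ h => D.Phi_injective h]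
    exact Finset.prod_congr rfl fun j _ => by rw [normPoly_rootConf]

/-- The action of the recursion on the density `r` relative to the product state `c`. -/
noncomputable def densityStep (D : GluingData k) (c : Fin k → Bool → ℕ[X]) (z : ℂ)
    (r : (Fin k → Bool) → ℂ) (y : Fin k → Bool) : ℂ :=
  multiAverage (D.kernel c z) Finset.univ (fun t => ∏ w, r (D.boundary w t)) (D.rootConf y)

theorem recursion_partition_eq (hz : D.IsDominated c z) {G : MarkedGraph k} {K : ℂ}
    {r : (Fin k → Bool) → ℂ} (hG : ∀ x, G.partition z x = K * refState c z x * r x)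
    (y : Fin k → Bool) : (D.recursion G).partition z y =
      (K ^ Fintype.card D.W * ∏ e with ¬ D.IsRooted e, aeval z (D.normPoly c e ∅)) *
        refState (D.refStep c) z y * D.densityStep c z r y := by
  rw [recursion_partition, mul_assoc (K ^ _), ← prod_normPoly_rootConf, densityStep, multiAverage,
    Finset.mul_sum]
  refine Finset.sum_congr rfl fun t _ => ?_
  simp only [hG, Finset.prod_mul_distrib, Finset.prod_const, Finset.card_univ, Finset.mem_univ,
    if_true]
  rw [prod_refState_boundary]
  have h1 : ∀ e, (if D.Match e (D.rootConf y e) (t e) ∧ (D.conn e).IsIndep (t e) then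
      z ^ D.exponent e (t e) else 0) *
      ∏ w : {w // w ∈ D.verts e}, aeval z (c (D.label e) (decide (D.attach e w ∈ t e))) =
      aeval z (D.normPoly c e (D.rootConf y e)) * D.kernel c z e (D.rootConf y e) (t e) := by
    intro e
    rw [normPoly_mul_kernel hz, aeval_weight]
    by_cases h1 : D.Match e (D.rootConf y e) (t e) <;>
      by_cases h2 : (D.conn e).IsIndep (t e) <;> simp [h1, h2]
  have h2 := Finset.prod_congr (rfl : (Finset.univ : Finset D.E) = Finset.univ) fun e _ => h1 e
  rw [Finset.prod_mul_distrib, Finset.prod_mul_distrib] at h2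
  linear_combination (K ^ Fintype.card D.W * ∏ w, r (D.boundary w t)) * h2

theorem rootConf_update (y : Fin k → Bool) (j : Fin k) (x : Bool) :
    D.rootConf (update y j x) =
      update (D.rootConf y) (D.Phi j) (if x = true then {D.root (D.Phi j)} else ∅) := by
  funext e
  by_cases he : e = D.Phi j
  · subst he
    rw [update_self]
    unfold rootConf
    refine if_congr ?_ rfl rfl
    constructor
    · rintro ⟨l, hl, h⟩
      rwa [D.Phi_injective hl, update_self] at h
    · intro h
      exact ⟨j, rfl, by rwa [update_self]⟩
  · rw [update_of_ne he]
    unfold rootConf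
    refine if_congr (exists_congr fun l => and_congr_right fun hl => ?_) rfl rfl
    rw [update_of_ne]
    rintro rfl
    exact he hl.symm

theorem hasInfluence_rootConf {f : D.Conf → ℂ} {a : D.E → ℝ} {b : D.E → D.E → ℝ}
    (h : HasInfluence f a b) :
    HasInfluence (S := fun _ : Fin k => Bool) (fun y => f (D.rootConf y)) (fun j => a (D.Phi j))
      (fun j l => b (D.Phi j) (D.Phi l)) := by
  refine ⟨fun y => h.ne_zero _, fun y j x => ?_, fun y j l hjl x u => ?_⟩
  · rw [rootConf_update]
    exact h.influence _ _ _
  · unfold mixedRatio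
    simp only [rootConf_update]
    exact h.interaction _ _ _ (fun he => hjl (D.Phi_injective he)) _ _

theorem hasInfluence_boundary {r : (Fin k → Bool) → ℂ} {a : Fin k → ℝ} {b : Fin k → Fin k → ℝ}
    (h : HasInfluence (S := fun _ : Fin k => Bool) r a b) (w : D.W) :
    HasInfluence (fun t => r (D.boundary w t)) (fun e => if w ∈ D.verts e then a (D.label e) else 0)
      (fun e g => if w ∈ D.verts e ∧ w ∈ D.verts g then b (D.label e) (D.label g) else 0) := by
  refine ⟨fun y => h.ne_zero _, fun t e u => ?_, fun t e g heg u v => ?_⟩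
  · by_cases hw : w ∈ D.verts e
    · rw [if_pos hw, D.boundary_update_of_mem t hw]
      exact h.influence _ _ _
    · rw [if_neg hw, D.boundary_update_of_notMem t hw, div_self (h.ne_zero _), sub_self, norm_zero]
  · unfold mixedRatio
    by_cases he : w ∈ D.verts e
    · by_cases hg : w ∈ D.verts g
      · rw [if_pos ⟨he, hg⟩]
        simp only [D.boundary_update_of_mem _ he, D.boundary_update_of_mem _ hg]
        refine h.interaction _ _ _ (fun hl => heg ?_) _ _
        rw [← D.edgeAt_label he, ← D.edgeAt_label hg, hl]
      · rw [if_neg fun h => hg h.2]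
        simp only [D.boundary_update_of_notMem _ hg]
        rw [mul_comm, div_self (mul_ne_zero (h.ne_zero _) (h.ne_zero _)), sub_self, norm_zero]
    · rw [if_neg fun h => he h.1]
      by_cases hg : w ∈ D.verts g
      · simp only [D.boundary_update_of_mem _ hg, D.boundary_update_of_notMem _ he]
        rw [div_self (mul_ne_zero (h.ne_zero _) (h.ne_zero _)), sub_self, norm_zero]
      · simp only [D.boundary_update_of_notMem _ hg, D.boundary_update_of_notMem _ he]
        rw [div_self (mul_ne_zero (h.ne_zero _) (h.ne_zero _)), sub_self, norm_zero]

theorem prod_one_add_ite {W : Type*} [Fintype W] (p : W → Prop) [DecidablePred p] (x : ℝ) :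
    ∏ w, (1 + if p w then x else 0) = (1 + x) ^ (Finset.univ.filter p).card := by
  have : ∀ w, (1 + if p w then x else 0) = if p w then 1 + x else 1 := fun w => by
    split_ifs <;> simp
  simp only [this]
  rw [Finset.prod_ite, Finset.prod_const, Finset.prod_const_one, mul_one]

theorem one_add_pow_card_filter_sub_one_le {W : Type*} [Fintype W] (p : W → Prop) [DecidablePred p]
    {x : ℝ} (h0 : 0 ≤ x) (h1 : x ≤ 1) :
    (1 + x) ^ (Finset.univ.filter p).card - 1 ≤ 2 ^ Fintype.card W * x := by
  refine (one_add_pow_sub_one_le _ h0 h1).trans (mul_le_mul_of_nonneg_right ?_ h0)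
  have : (2 : ℝ) ^ (Finset.univ.filter p).card ≤ 2 ^ Fintype.card W :=
    pow_le_pow_right₀ (by norm_num) (Finset.card_le_univ _)
  linarith

/-- Two different labels are linked if the edges `Φ(j)` and `Φ(l)` meet. -/
def Linked (D : GluingData k) (j l : Fin k) : Prop :=
  j ≠ l ∧ ∃ w, w ∈ D.verts (D.Phi j) ∧ w ∈ D.verts (D.Phi l)

theorem exists_densityStep_bound (hstable : D.IsStable) :
    ∃ C : ℝ, 1 ≤ C ∧ ∃ δ : ℝ, 0 < δ ∧ ∀ (c : Fin k → Bool → ℕ[X]) (z : ℂ)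
      (r : (Fin k → Bool) → ℂ) (a : Fin k → ℝ) (b : Fin k → Fin k → ℝ) (M : ℝ),
      D.IsDominated c z → HasInfluence (S := fun _ : Fin k => Bool) r a b →
      (∀ j, 0 ≤ a j) → (∀ j l, 0 ≤ b j l) → (∀ j, a j ≤ δ) → (∀ j l, b j l ≤ M) → 0 ≤ M → M ≤ δ →
      HasInfluence (S := fun _ : Fin k => Bool) (D.densityStep c z r)
        (fun j => if j ∈ periodicPts D.labelMap then a (D.labelMap j) + C * M
          else C * (a (D.labelMap j) + M))
        (fun j l => C * ((if D.Linked j l then b (D.labelMap j) (D.labelMap l) else 0) + M ^ 2)) := by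
  obtain ⟨C, hC, hmulti⟩ := HasInfluence.exists_multiAverage
    (S := fun e : D.E => Finset (D.conn e).V) Finset.univ
  set Q : ℝ := 2 ^ Fintype.card D.W with hQdef
  have hQ : 1 ≤ Q := one_le_pow₀ (by norm_num)
  have hQQ : Q ≤ Q ^ 2 := by nlinarith
  refine ⟨C * Q ^ 2, by nlinarith, 1 / (16 * C * Q), by positivity, ?_⟩
  intro c z r a b M hz hr ha0 hb0 ha hb hM0 hM
  have hδ1 : 1 / (16 * C * Q) ≤ 1 := by
    rw [div_le_one (by positivity)]
    nlinarith
  have hsmall : ∀ x, x ≤ 1 / (16 * C * Q) → C * (Q * x) ≤ 1 / 16 := by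
    intro x hx
    rw [le_div_iff₀ (by positivity)] at hx
    linarith
  have hf := HasInfluence.prod Finset.univ fun w => hasInfluence_boundary (D := D) hr w
  simp only [prod_one_add_ite] at hf
  have haf : ∀ e, (1 + a (D.label e)) ^ (Finset.univ.filter fun w => w ∈ D.verts e).card - 1 ≤
      Q * a (D.label e) := fun e =>
    one_add_pow_card_filter_sub_one_le _ (ha0 _) ((ha _).trans hδ1)
  have hbf : ∀ e g, (1 + b (D.label e) (D.label g)) ^
      (Finset.univ.filter fun w => w ∈ D.verts e ∧ w ∈ D.verts g).card - 1 ≤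
      Q * b (D.label e) (D.label g) := fun e g =>
    one_add_pow_card_filter_sub_one_le _ (hb0 _ _) (((hb _ _).trans hM).trans hδ1)
  have hres := hmulti _ _ _ (Q * M) (D.kernel c z)
    (fun e => ∃ j ∈ periodicPts D.labelMap, D.Phi j = e) hf
    (fun e => sub_nonneg.2 (one_le_pow₀ (by linarith [ha0 (D.label e)])))
    (fun e g => sub_nonneg.2 (one_le_pow₀ (by linarith [hb0 (D.label e) (D.label g)])))
    (fun e => (mul_le_mul_of_nonneg_left (haf e) (by linarith)).trans (hsmall _ (ha _)))
    (fun e g => (hbf e g).trans (mul_le_mul_of_nonneg_left (hb _ _) (by linarith)))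
    (by positivity) (hsmall _ hM) (fun e s => sum_kernel e s)
    (fun e s => sum_norm_kernel_le hz e s) (by
      rintro _ ⟨j, hj, rfl⟩ s t
      exact kernel_of_periodic hstable hj s t)
  refine (hasInfluence_rootConf hres).mono (fun j => ?_) (fun j l hjl => ?_)
  · have hCQM : C * (Q * M) ≤ C * Q ^ 2 * M := by
      rw [mul_assoc]
      exact mul_le_mul_of_nonneg_left (mul_le_mul_of_nonneg_right hQQ hM0) (by linarith)
    by_cases hj : j ∈ periodicPts D.labelMap
    · rw [if_pos ⟨j, hj, rfl⟩, if_pos hj]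
      have hcard : (Finset.univ.filter fun w => w ∈ D.verts (D.Phi j)).card = 1 := by
        have h1 := hstable.1 j hj
        have h2 := (D.verts_nonempty (D.Phi j)).card_pos
        unfold IsCritical at h1
        rw [Finset.filter_univ_mem]
        omega
      rw [hcard, pow_one, add_sub_cancel_left]
      exact add_le_add le_rfl hCQM
    · rw [if_neg hj, if_neg]
      · have h1 := mul_le_mul_of_nonneg_left (haf (D.Phi j)) (by linarith : 0 ≤ C)
        have h2 : C * (Q * a (D.label (D.Phi j))) ≤ C * Q ^ 2 * a (D.label (D.Phi j)) := by
          rw [mul_assoc]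
          exact mul_le_mul_of_nonneg_left (mul_le_mul_of_nonneg_right hQQ (ha0 _)) (by linarith)
        rw [mul_add, mul_add]
        exact add_le_add (h1.trans h2) hCQM
      · rintro ⟨l, hl, h⟩
        rw [D.Phi_injective h] at hl
        exact hj hl
  · rw [mul_assoc]
    refine mul_le_mul_of_nonneg_left ?_ (by linarith)
    rw [mul_add, mul_pow]
    refine add_le_add ?_ le_rfl
    by_cases h : D.Linked j l
    · rw [if_pos h]
      exact (hbf _ _).trans (mul_le_mul_of_nonneg_right hQQ (hb0 _ _))
    · rw [if_neg h, mul_zero]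
      have : (Finset.univ.filter fun w => w ∈ D.verts (D.Phi j) ∧ w ∈ D.verts (D.Phi l)) = ∅ := by
        rw [Finset.filter_eq_empty_iff]
        exact fun w _ hw => h ⟨hjl, w, hw⟩
      rw [this, Finset.card_empty, pow_zero, sub_self]

theorem exists_mem_verts_iterateSucc (n : ℕ) {j l : Fin k}
    (h : ∀ i < n + 1, D.Linked (D.labelMap^[i] j) (D.labelMap^[i] l)) :
    ∃ w, w ∈ (D.iterateSucc n).verts ((D.iterateSucc n).Phi j) ∧
      w ∈ (D.iterateSucc n).verts ((D.iterateSucc n).Phi l) := by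
  induction n generalizing j l with
  | zero => exact (h 0 (by omega)).2
  | succ n ih =>
    obtain ⟨w, hj, hl⟩ := (h 0 (by omega)).2
    obtain ⟨v, hvj, hvl⟩ := ih (j := D.labelMap j) (l := D.labelMap l)
      fun i hi => h (i + 1) (by omega)
    exact ⟨(w, v), Finset.mem_product.2 ⟨hj, hvj⟩, Finset.mem_product.2 ⟨hl, hvl⟩⟩

theorem IsExpanding.exists_not_linked (hexp : D.IsExpanding) :
    ∃ N, ∀ j l, ∃ i < N, ¬ D.Linked (D.labelMap^[i] j) (D.labelMap^[i] l) := by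
  obtain ⟨n, hn⟩ := hexp
  refine ⟨n + 1, fun j l => ?_⟩
  by_contra! h
  obtain ⟨w, hj, hl⟩ := exists_mem_verts_iterateSucc n h
  exact Finset.disjoint_left.1 (hn j l (h 0 (by omega)).1) hj hl

end GluingData

namespace MarkedGraph

open Classical Filter Bornology

variable {k : ℕ} {G : MarkedGraph k}

theorem isIndep_mono {G : Multigraph} {I J : Finset G.V} (h : G.IsIndep I) (hJ : J ⊆ I) :
    G.IsIndep J :=
  fun e he hv => h e he fun v hve => hJ (hv v hve)

/-- In a maximally independent graph, all maximal sets have the same number of unmarked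
vertices. -/
theorem IsMaximallyIndependent.exists_numUnmarked (h : G.IsMaximallyIndependent) :
    ∃ d : ℕ, ∀ x, ∃ I, (G.IsIndep I ∧ G.Agrees x I) ∧ G.numUnmarked I = d ∧
      ∀ J, G.IsIndep J → G.Agrees x J → J ≠ I → G.numUnmarked J < d := by
  obtain ⟨I, hI, hcard⟩ := h
  have hle : ∀ x J, G.IsIndep J → G.Agrees x J → G.numUnmarked J ≤ G.numUnmarked (I x) := by
    intro x J hJ hx
    have h1 := (hI x).1.2.2 J hJ hx
    rw [hx.card_eq, (hI x).1.2.1.card_eq] at h1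
    omega
  have hall : (Finset.univ.filter fun _ : Fin k => (true = true)).card = k := by simp
  have hnone : (Finset.univ.filter fun _ : Fin k => (false = true)).card = 0 := by simp
  have hends : G.numUnmarked (I fun _ => true) = G.numUnmarked (I fun _ => false) := by
    rw [(hI fun _ => true).1.2.1.card_eq, (hI fun _ => false).1.2.1.card_eq, hall, hnone] at hcard
    push_cast at hcard
    omega
  have hmono : ∀ x y : Fin k → Bool, (∀ j, y j = true → x j = true) →
      G.numUnmarked (I x) ≤ G.numUnmarked (I y) := by
    intro x y hxy
    set J := (I x).filter fun v => ∀ j, G.mark j = v → y j = true with hJ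
    have hJx : G.numUnmarked J = G.numUnmarked (I x) := by
      unfold numUnmarked
      congr 1
      ext v
      simp only [hJ, Finset.mem_filter]
      constructor
      · rintro ⟨⟨h1, -⟩, h2⟩
        exact ⟨h1, h2⟩
      · rintro ⟨h1, h2⟩
        exact ⟨⟨h1, fun j hj => absurd ⟨j, hj⟩ h2⟩, h2⟩
    rw [← hJx]
    refine hle y J (isIndep_mono (hI x).1.1 (Finset.filter_subset _ _)) fun j => ?_
    rw [hJ, Finset.mem_filter, (hI x).1.2.1 j]
    constructor
    · exact fun h => h.2 j rfl
    · exact fun h => ⟨hxy j h, fun l hl => by rwa [G.mark_injective hl]⟩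
  have heq : ∀ x, G.numUnmarked (I x) = G.numUnmarked (I fun _ => false) := fun x =>
    le_antisymm (hmono _ _ fun j hj => absurd hj (by simp))
      (hends ▸ hmono (fun _ => true) x fun _ _ => rfl)
  refine ⟨G.numUnmarked (I fun _ => false), fun x => ⟨I x, ⟨(hI x).1.1, (hI x).1.2.1⟩, heq x,
    fun J hJ hx hne => ?_⟩⟩
  rw [← heq x]
  refine lt_of_le_of_ne (hle x J hJ hx) fun he => hne ((hI x).2 J ⟨hJ, hx, fun J' hJ' hx' => ?_⟩)
  have h1 := (hI x).1.2.2 J' hJ' hx'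
  rw [(hI x).1.2.1.card_eq] at h1
  rwa [hx.card_eq, he]

theorem IsMaximallyIndependent.exists_partition_near (h : G.IsMaximallyIndependent) :
    ∃ d : ℕ, ∀ η > 0, ∀ᶠ z in cobounded ℂ, z ≠ 0 ∧ ∀ x, ‖G.partition z x / z ^ d - 1‖ ≤ η := by
  obtain ⟨d, hd⟩ := h.exists_numUnmarked
  refine ⟨d, fun η hη => ?_⟩
  set B : ℝ := (Fintype.card (Finset G.V) : ℝ) with hB
  have h1 : ∀ᶠ z : ℂ in cobounded ℂ, max 1 (B / η) ≤ ‖z‖ :=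
    tendsto_norm_cobounded_atTop.eventually_ge_atTop _
  filter_upwards [h1] with z hz
  have hz1 : 1 ≤ ‖z‖ := (le_max_left _ _).trans hz
  have hzB : B ≤ η * ‖z‖ := by
    have := (le_max_right _ _).trans hz
    rwa [div_le_iff₀' hη] at this
  have hz0 : z ≠ 0 := norm_pos_iff.1 (by linarith)
  refine ⟨hz0, fun x => ?_⟩
  obtain ⟨I, hI, hId, hlt⟩ := hd x
  have hmem : I ∈ Finset.univ.filter fun I => G.IsIndep I ∧ G.Agrees x I :=
    Finset.mem_filter.2 ⟨Finset.mem_univ _, hI⟩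
  have hpos : 0 < ‖z ^ d‖ := norm_pos_iff.2 (pow_ne_zero _ hz0)
  rw [div_sub_one (pow_ne_zero _ hz0), norm_div, div_le_iff₀ hpos, partition,
    ← Finset.add_sum_erase _ _ hmem, hId, add_sub_cancel_left]
  have hterm : ∀ J ∈ (Finset.univ.filter fun I => G.IsIndep I ∧ G.Agrees x I).erase I,
      ‖z ^ G.numUnmarked J‖ ≤ ‖z‖ ^ d / ‖z‖ := by
    intro J hJ
    obtain ⟨hne, hJ⟩ := Finset.mem_erase.1 hJ
    have hJ := (Finset.mem_filter.1 hJ).2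
    rw [norm_pow, le_div_iff₀ (by linarith), ← pow_succ]
    exact pow_le_pow_right₀ hz1 (hlt J hJ.1 hJ.2 hne)
  refine (norm_sum_le_of_le _ hterm).trans ?_
  rw [Finset.sum_const, nsmul_eq_mul, norm_pow]
  have hcard : (((Finset.univ.filter fun I => G.IsIndep I ∧ G.Agrees x I).erase I).card : ℝ) ≤ B :=
    Nat.cast_le.2 (Finset.card_le_univ _)
  have hq : 0 ≤ ‖z‖ ^ d / ‖z‖ := by positivity
  calc _ ≤ η * ‖z‖ * (‖z‖ ^ d / ‖z‖) := mul_le_mul_of_nonneg_right (hcard.trans hzB) hq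
    _ = η * ‖z‖ ^ d := by
      have : ‖z‖ ≠ 0 := by linarith
      field_simp

end MarkedGraph

section NearOne

variable {ι : Type*} [DecidableEq ι] {S : ι → Type*}

theorem HasInfluence.of_near_one {f : (∀ i, S i) → ℂ} {η : ℝ} (hη : η ≤ 1 / 4)
    (h : ∀ s, ‖f s - 1‖ ≤ η) : HasInfluence f (fun _ => 12 * η) (fun _ _ => 12 * η) := by
  have hdiv : ∀ s t, ‖f s / f t - 1‖ ≤ 3 * η := by
    intro s t
    have h1 := norm_sub_le (f s - 1) (f t - 1)
    rw [sub_sub_sub_cancel_right] at h1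
    refine (norm_div_sub_one_le (c := 1 / 4) (d := 2 * η) (by norm_num) ((h t).trans hη)
      (by linarith [h s, h t])).trans ?_
    rw [div_le_iff₀ (by norm_num)]
    linarith [(norm_nonneg _).trans (h s)]
  refine ⟨fun s h0 => ?_, fun s i t => ?_, fun s i j _ t u => ?_⟩
  · have := h s
    rw [h0, zero_sub, norm_neg, norm_one] at this
    linarith
  · exact (hdiv _ _).trans (by linarith [(norm_nonneg _).trans (h s)])
  · rw [mixedRatio, mul_div_mul_comm]
    refine (norm_mul_sub_one_le (hdiv _ _) (hdiv _ _)).trans ?_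
    nlinarith [(norm_nonneg _).trans (h s)]

theorem HasInfluence.norm_div_sub_one_le {f : (∀ i, S i) → ℂ} {a : ι → ℝ} {b : ι → ι → ℝ}
    (h : HasInfluence f a b) {δ : ℝ} (hδ : ∀ i, a i ≤ δ) (s t : ∀ i, S i) (A : Finset ι)
    (hst : ∀ i ∉ A, s i = t i) : ‖f s / f t - 1‖ ≤ (1 + δ) ^ A.card - 1 := by
  induction A using Finset.induction_on generalizing s with
  | empty =>
    obtain rfl : s = t := funext fun i => hst i (Finset.notMem_empty i)
    simp [div_self (h.ne_zero s)]
  | insert o A ho ih =>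
    have h1 := ih (Function.update s o (t o)) (fun i hi => by
      by_cases hio : i = o
      · subst hio
        rw [Function.update_self]
      · rw [Function.update_of_ne hio]
        exact hst i (by simp [hio, hi]))
    have h2 := (h.influence (Function.update s o (t o)) o (s o)).trans (hδ o)
    rw [Function.update_idem, Function.update_eq_self] at h2
    have h3 := norm_mul_sub_one_le h2 h1
    rw [div_mul_div_cancel₀ (h.ne_zero _)] at h3
    rw [Finset.card_insert_of_notMem ho, pow_succ]
    linarith

end NearOne

namespace GluingData

open Classical Polynomial Filter Bornology Function

variable {k : ℕ} {D : GluingData k}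

/-- The contribution of the boundary values `x` to the independence polynomial of the product state
with factors `c`. -/
noncomputable def fullWeight (c : Fin k → Bool → ℕ[X]) (x : Fin k → Bool) : ℕ[X] :=
  X ^ (Finset.univ.filter fun j => x j = true).card * ∏ j, c j (x j)

theorem eventually_fullWeight (hstable : D.IsStable) : ∀ᶠ z in cobounded ℂ, ∀ n,
    (∑ x, ‖aeval z (fullWeight (D.refSeq n) x)‖ ≤ 2 * ‖∑ x, aeval z (fullWeight (D.refSeq n) x)‖) ∧
      ∑ x, aeval z (fullWeight (D.refSeq n) x) ≠ 0 := by
  refine D.eventually_forall_refSeq hstable (p := fun c z =>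
    (∑ x, ‖aeval z (fullWeight c x)‖ ≤ 2 * ‖∑ x, aeval z (fullWeight c x)‖) ∧
      ∑ x, aeval z (fullWeight c x) ≠ 0) fun n => ?_
  have hne : ∑ x, fullWeight (D.refSeq n) x ≠ 0 := by
    intro h0
    have : 0 < (∑ x, fullWeight (D.refSeq n) x).eval 1 := by
      refine eval_sum_pos (t := fun _ => false) (Finset.mem_univ _) ?_
      simp only [fullWeight, eval_mul, eval_pow, eval_X, one_pow, one_mul, eval_prod]
      exact Finset.prod_pos fun j _ => D.eval_refSeq_pos n j
    simp [h0] at this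
  filter_upwards [eventually_sum_norm_aeval_le Finset.univ (fullWeight (D.refSeq n)),
    eventually_aeval_ne_zero hne] with z h1 h2
  rw [map_sum] at h2
  exact ⟨h1, h2⟩

theorem eventually_normPoly_ne_zero (hstable : D.IsStable) : ∀ᶠ z in cobounded ℂ, ∀ n,
    ∏ e with ¬ D.IsRooted e, aeval z (D.normPoly (D.refSeq n) e ∅) ≠ 0 := by
  refine D.eventually_forall_refSeq hstable (p := fun c z =>
    ∏ e with ¬ D.IsRooted e, aeval z (D.normPoly c e ∅) ≠ 0) fun n => ?_
  have : ∀ᶠ z : ℂ in cobounded ℂ, ∀ e ∈ Finset.univ.filter fun e => ¬ D.IsRooted e,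
      aeval z (D.normPoly (D.refSeq n) e ∅) ≠ 0 :=
    (eventually_all_finset _).2 fun e he =>
      eventually_aeval_ne_zero (D.normPoly_ne_zero (Finset.mem_filter.1 he).2 n ∅)
  filter_upwards [this] with z hz
  exact Finset.prod_ne_zero_iff.2 hz

/-- The partition functions of `G_n` stay close to product states near infinity. -/
theorem exists_partition_graphSeq (hstable : D.IsStable) (hexp : D.IsExpanding)
    {G : MarkedGraph k} (hG : G.IsMaximallyIndependent) {δ : ℝ} (hδ : 0 < δ) :
    ∀ᶠ z in cobounded ℂ, ∀ n, ∃ (K : ℂ) (r : (Fin k → Bool) → ℂ) (a : Fin k → ℝ)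
      (b : Fin k → Fin k → ℝ), K ≠ 0 ∧ HasInfluence (S := fun _ : Fin k => Bool) r a b ∧
      (∀ j, a j ≤ δ) ∧
      ∀ x, (D.graphSeq G n).partition z x = K * refState (D.refSeq n) z x * r x := by
  obtain ⟨C, hC, δ₀, hδ₀, hstep⟩ := exists_densityStep_bound hstable
  obtain ⟨N, hN⟩ := hexp.exists_not_linked
  obtain ⟨ε, hε, hseq⟩ := exists_influenceSeq_le hN hC (lt_min hδ hδ₀)
  obtain ⟨d, hd⟩ := hG.exists_partition_near
  filter_upwards [hd (min (ε / 12) (1 / 4)) (by positivity), eventually_isDominated hstable,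
    eventually_normPoly_ne_zero hstable] with z hz hdom hne
  suffices h : ∀ n, ∃ (K : ℂ) (r : (Fin k → Bool) → ℂ), K ≠ 0 ∧
      HasInfluence (S := fun _ : Fin k => Bool) r (influenceSeq D.labelMap D.Linked C ε n).1
        (influenceSeq D.labelMap D.Linked C ε n).2 ∧
      ∀ x, (D.graphSeq G n).partition z x = K * refState (D.refSeq n) z x * r x by
    intro n
    obtain ⟨K, r, hK, hr, hp⟩ := h n
    exact ⟨K, r, _, _, hK, hr, fun j => ((hseq n).1 j).trans (min_le_left _ _), hp⟩
  intro n
  induction n with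
  | zero =>
    refine ⟨z ^ d, fun x => G.partition z x / z ^ d, pow_ne_zero _ hz.1, ?_, fun x => ?_⟩
    · refine (HasInfluence.of_near_one (min_le_right _ _) hz.2).mono (fun j => ?_)
        (fun j l _ => ?_)
      all_goals
        change 12 * min (ε / 12) (1 / 4) ≤ ε
        linarith [min_le_left (ε / 12) (1 / 4)]
    · simp only [graphSeq, refState, refSeq, map_one, Finset.prod_const_one, mul_one]
      rw [mul_div_cancel₀ _ (pow_ne_zero _ hz.1)]
  | succ n ih =>
    obtain ⟨K, r, hK, hr, hp⟩ := ih
    refine ⟨_, _, mul_ne_zero (pow_ne_zero (Fintype.card D.W) hK) (hne n), ?_,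
      recursion_partition_eq (hdom n) hp⟩
    exact hstep (D.refSeq n) z r _ _ _ (hdom n) hr
      (fun j => influenceSeq_fst_nonneg hC hε.le n j)
      (fun j l => influenceSeq_snd_nonneg hC hε.le n j l)
      (fun j => ((hseq n).1 j).trans (min_le_right _ _))
      (fun j l => influenceSeq_snd_le_total hC hε.le n j l)
      (totalInteraction_nonneg hC hε.le n) ((hseq n).2.trans (min_le_right _ _))

theorem eventually_eval_indepPoly_ne_zero (hstable : D.IsStable) (hexp : D.IsExpanding)
    {G : MarkedGraph k} (hG : G.IsMaximallyIndependent) :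
    ∀ᶠ z in cobounded ℂ, ∀ n, (D.graphSeq G n).indepPoly.eval z ≠ 0 := by
  set δ : ℝ := 1 / (4 * 2 ^ k) with hδdef
  have hδ : 0 < δ := by positivity
  have h2k : (1 : ℝ) ≤ 2 ^ k := one_le_pow₀ (by norm_num)
  have hδ1 : δ ≤ 1 := by
    rw [hδdef, div_le_one (by positivity)]
    linarith
  filter_upwards [exists_partition_graphSeq hstable hexp hG hδ, eventually_fullWeight hstable]
    with z hz hw n h0
  obtain ⟨K, r, a, b, hK, hr, ha, hp⟩ := hz n
  obtain ⟨hdom, hne⟩ := hw n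
  set v : (Fin k → Bool) → ℂ := fun x => aeval z (fullWeight (D.refSeq n) x) with hv
  set ρ : (Fin k → Bool) → ℂ := fun x => r x / r fun _ => false with hρ
  have hρ1 : ∀ x, ‖ρ x - 1‖ ≤ 1 / 4 := by
    intro x
    refine (hr.norm_div_sub_one_le ha x (fun _ => false) Finset.univ (by simp)).trans ?_
    rw [Finset.card_univ, Fintype.card_fin]
    refine (one_add_pow_sub_one_le k hδ.le hδ1).trans ?_
    have : 2 ^ k * δ = 1 / 4 := by
      rw [hδdef]
      field_simp
    linarith
  have e : (D.graphSeq G n).indepPoly.eval z = K * (r fun _ => false) * ∑ x, v x * ρ x := by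
    rw [MarkedGraph.eval_indepPoly, Finset.mul_sum]
    refine Finset.sum_congr rfl fun x _ => ?_
    have h1 := hr.ne_zero fun _ => false
    simp only [hp, hv, hρ, fullWeight, refState, map_mul, map_pow, map_prod, aeval_X]
    field_simp
  rw [e] at h0
  have hsum := (mul_eq_zero.1 h0).resolve_left (mul_ne_zero hK (hr.ne_zero _))
  have e2 : ∑ x, v x = -∑ x, v x * (ρ x - 1) := by
    simp only [mul_sub, mul_one, Finset.sum_sub_distrib, hsum]
    ring
  have h3 := norm_sum_mul_le hdom (by norm_num) hρ1
  have h4 : ‖∑ x, v x‖ = ‖∑ x, v x * (ρ x - 1)‖ := by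
    conv_lhs => rw [e2]
    exact norm_neg _
  have h5 : 0 < ‖∑ x, v x‖ := norm_pos_iff.2 hne
  linarith

end GluingData

theorem mainTheorem1 (k : ℕ) (hk : 2 ≤ k) (D : GluingData k) (hm : 2 ≤ Fintype.card D.W)
    (hstable : D.IsStable) (hexp : D.IsExpanding)
    (G₀ : MarkedGraph k) (hG₀ : G₀.IsMaximallyIndependent) :
    ∃ C : ℝ, ∀ (n : ℕ) (z : ℂ), (D.graphSeq G₀ n).indepPoly.IsRoot z → ‖z‖ ≤ C := by
  obtain ⟨C, -, hC⟩ := (Filter.hasBasis_cobounded_norm (E := ℂ)).eventually_iff.1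
    (GluingData.eventually_eval_indepPoly_ne_zero hstable hexp hG₀)
  refine ⟨C, fun n z hz => ?_⟩
  by_contra! h
  exact hC h.le n hz
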